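/- Let $\omega\subset\mathbb{R}^d$ be a connected, unbounded open set that is periodic with respect to $\mathbb{Z}^d$, such that $\mathbb{R}^d\setminus\omega=\bigcup_k\overline{F_k}$, where each $F_k$ is a bounded Lipschitz domain with connected boundary, the closures $\overline{F_k}$ are mutually disjoint, and $\inf_{k\ne m}\operatorname{dist}(F_k,F_m)>0$. Put $F=\bigcup_kF_k=\mathbb{R}^d\setminus\overline{\omega}$ and $Q_R=(-R/2,R/2)^d$. Let $\kappa_1,\kappa_2>0$ and let $A=(a_{ij}^{\alpha\beta}(x))$, $1\le i,j,\alpha,\beta\le d$, be real, bounded, measurable, $\mathbb{Z}^d$-periodic, and satisfy $$a_{ij}^{\alpha\beta}=a_{ji}^{\beta\alpha}=a_{\alpha j}^{i\beta},\qquad \kappa_1|\xi|^2\le a_{ij}^{\alpha\beta}\xi_i^\alpha\xi_j^\beta\le\kappa_2|\xi|^2$$ for every symmetric matrix $\xi=(\xi_i^\alpha)\in\mathbb{R}^{d\times d}$ (repeated indices are summed). Write $Du=\frac12(\nabla u+(\nabla u)^T)$. A function $u\in H^1(\Omega;\mathbb{R}^d)$ is called a weak solution of $\mathcal{L}_\infty(u)=0$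 in $\Omega$ (stiff inclusions, $\delta=\infty$) if $Du=0$ in $\Omega\cap F$ and $$\int_{\Omega\cap\omega}A\nabla u\cdot\nabla v\,dx=0\qquad\text{for all }v\in H_0^1(\Omega;\mathbb{R}^d)\text{ with }Dv=0\text{ in }\Omega\cap F,$$ where $A\nabla u\cdot\nabla v=a_{ij}^{\alpha\beta}\,\partial_ju^\beta\,\partial_iv^\alpha$. **Theorem.** For every real $\ell\ge1$ there is a constant $C>0$, depending only on $d$, $\kappa_1$, $\kappa_2$, $\ell$ and $\omega$, such that for every $R\ge32$ and every weak solution $u\in H^1(Q_R;\mathbb{R}^d)$ of $\mathcal{L}_\infty(u)=0$ in $Q_R$, $$\int_{Q_{R/2}}|\nabla u|^2\,dx\le\frac{C}{R^2}\int_{Q_R}|u|^2\,dx+\frac{C}{R^{2\ell}}\int_{Q_R}|\nabla u|^2\,dx.$$ -/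

import Mathlib

open MeasureTheory

namespace StiffInclusion

noncomputable section

/-- The Euclidean space `ℝ^d`. -/
abbrev Space (d : ℕ) := EuclideanSpace ℝ (Fin d)

/-- Real `d × d` matrices `ξ = (ξ_i^α)`, written `ξ i α`.  The gradient of a vector field `u` is the
matrix whose entry `i α` is the partial derivative of the component `u^α` in direction `i`. -/
abbrev Mat (d : ℕ) := Fin d → Fin d → ℝ

/-- Tensors `a = (a_{ij}^{αβ})`, written `a i j α β`. -/
abbrev Tensor (d : ℕ) := Fin d → Fin d → Fin d → Fin d → ℝ

/-- The vector of `ℝ^d` with integer coordinates `z`. -/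
def intVec {d : ℕ} (z : Fin d → ℤ) : Space d := WithLp.toLp 2 (fun i => (z i : ℝ))

/-- The open cube `Q_R = (-R/2, R/2)^d`. -/
def cube (d : ℕ) (R : ℝ) : Set (Space d) := {x | ∀ i, -(R / 2) < x i ∧ x i < R / 2}

/-! ### Geometry of the inclusions -/

/-- Near the point `p`, the set `F` is the region strictly above the graph of a Lipschitz function
in a suitable orthonormal coordinate system, whose last axis is spanned by the unit vector `n`; the
graph function `γ` is only evaluated on the hyperplane orthogonal to `n`. -/
def IsLipschitzGraphAt {d : ℕ} (F : Set (Space d)) (p : Space d) : Prop :=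
  ∃ (r : ℝ) (n : Space d) (γ : Space d → ℝ) (K : NNReal),
    0 < r ∧ ‖n‖ = 1 ∧ LipschitzWith K γ ∧
    ∀ x ∈ Metric.ball p r, (x ∈ F ↔ γ (x - inner ℝ x n • n) < inner ℝ x n)

/-- Bounded Lipschitz domains: bounded, open, connected (and nonempty) sets whose boundary is
locally the graph of a Lipschitz function, with the set on one side of it. -/
structure IsBoundedLipschitzDomain {d : ℕ} (F : Set (Space d)) : Prop where
  isOpen : IsOpen F
  isConnected : IsConnected F
  isBounded : Bornology.IsBounded F
  lipschitz : ∀ p ∈ frontier F, IsLipschitzGraphAt F p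

/-- `ω` is a connected, unbounded, 1-periodic open set, and `ℝ^d \ ω` is the union of the closures
of the members `F_k` of the family `Fs`, which are bounded Lipschitz domains with connected boundary,
have mutually disjoint closures, and lie at mutual distances bounded below by a positive number. -/
structure IsMatrixWithInclusions {d : ℕ} (ω : Set (Space d)) (Fs : Set (Set (Space d))) :
    Prop where
  isOpen : IsOpen ω
  isConnected : IsConnected ω
  unbounded : ¬ Bornology.IsBounded ω
  periodic : ∀ (z : Fin d → ℤ) (x : Space d), x + intVec z ∈ ω ↔ x ∈ ω
  domain : ∀ F ∈ Fs, IsBoundedLipschitzDomain F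
  connected_boundary : ∀ F ∈ Fs, IsConnected (frontier F)
  compl_eq : ωᶜ = ⋃ F ∈ Fs, closure F
  disjoint : ∀ F ∈ Fs, ∀ G ∈ Fs, F ≠ G → Disjoint (closure F) (closure G)
  dist_pos : ∃ c : ℝ, 0 < c ∧ ∀ F ∈ Fs, ∀ G ∈ Fs, F ≠ G → ∀ x ∈ F, ∀ y ∈ G, c ≤ dist x y

/-- The standing geometric assumption on `ω` alone (the family of the inclusions is determined
by `ω`: their closures are the connected components of `ℝ^d \ ω`). -/
def IsAdmissible {d : ℕ} (ω : Set (Space d)) : Prop :=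
  ∃ Fs : Set (Set (Space d)), IsMatrixWithInclusions ω Fs

/-- The region `F = ℝ^d \ closure ω` occupied by the inclusions.  For an admissible `ω` it is the
union of the `F_k`, because a Lipschitz domain is the interior of its closure. -/
def inclusions {d : ℕ} (ω : Set (Space d)) : Set (Space d) := (closure ω)ᶜ

/-! ### Coefficients -/

/-- The elasticity condition with constants `κ₁`, `κ₂` for a single tensor. -/
structure IsElastic {d : ℕ} (κ₁ κ₂ : ℝ) (a : Tensor d) : Prop where
  symm₁ : ∀ i j α β, a i j α β = a j i β α
  symm₂ : ∀ i j α β, a i j α β = a α j i β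
  lower : ∀ ξ : Mat d, (∀ i α, ξ i α = ξ α i) →
    κ₁ * (∑ i, ∑ α, ξ i α ^ 2) ≤ ∑ i, ∑ j, ∑ α, ∑ β, a i j α β * ξ i α * ξ j β
  upper : ∀ ξ : Mat d, (∀ i α, ξ i α = ξ α i) →
    ∑ i, ∑ j, ∑ α, ∑ β, a i j α β * ξ i α * ξ j β ≤ κ₂ * (∑ i, ∑ α, ξ i α ^ 2)

/-- Lebesgue measurable, 1-periodic coefficients that satisfy the elasticity condition (almost
everywhere).  Essential boundedness is a consequence of the elasticity condition. -/
structure IsCoefficient {d : ℕ} (κ₁ κ₂ : ℝ) (A : Space d → Tensor d) : Prop where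
  measurable : ∀ i j α β, AEMeasurable (fun x => A x i j α β) volume
  periodic : ∀ z : Fin d → ℤ, ∀ᵐ x ∂(volume : Measure (Space d)), A (x + intVec z) = A x
  elastic : ∀ᵐ x ∂(volume : Measure (Space d)), IsElastic κ₁ κ₂ (A x)

/-- `A ξ · ζ = a_{ij}^{αβ} ξ_j^β ζ_i^α`. -/
def contract {d : ℕ} (a : Tensor d) (ξ ζ : Mat d) : ℝ :=
  ∑ i, ∑ j, ∑ α, ∑ β, a i j α β * ξ j β * ζ i α

/-! ### Sobolev spaces -/

/-- `|ξ|²`, the squared Frobenius norm. -/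
def normSq {d : ℕ} (ξ : Mat d) : ℝ := ∑ i, ∑ α, ξ i α ^ 2

/-- The symmetric part `(ξ + ξᵀ) / 2`; applied to the gradient of `u` it gives `Du`. -/
def symPart {d : ℕ} (ξ : Mat d) : Mat d := fun i α => (ξ i α + ξ α i) / 2

/-- Partial derivative of a differentiable scalar function in the `i`-th coordinate direction. -/
def partialDeriv {d : ℕ} (i : Fin d) (φ : Space d → ℝ) (x : Space d) : ℝ :=
  fderiv ℝ φ x (EuclideanSpace.single i 1)

/-- Classical gradient matrix of a differentiable vector field. -/
def gradient {d : ℕ} (φ : Space d → Space d) (x : Space d) : Mat d :=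
  fun i α => partialDeriv i (fun y => φ y α) x

/-- `u ∈ H¹(Ω; ℝ^d)` with weak gradient `gu`: both lie in `L²(Ω)`, and `gu x i α` is the weak
partial derivative in direction `i` of the component `u^α`, tested against `C_c^∞(Ω)`. -/
structure MemH1 {d : ℕ} (Ω : Set (Space d)) (u : Space d → Space d) (gu : Space d → Mat d) :
    Prop where
  memLp : MemLp u 2 (volume.restrict Ω)
  memLp_grad : ∀ i α, MemLp (fun x => gu x i α) 2 (volume.restrict Ω)
  weak : ∀ φ : Space d → ℝ, ContDiff ℝ (⊤ : ℕ∞) φ → HasCompactSupport φ → tsupport φ ⊆ Ω →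
    ∀ i α, ∫ x in Ω, u x α * partialDeriv i φ x = - ∫ x in Ω, gu x i α * φ x

/-- `v ∈ H¹₀(Ω; ℝ^d)` with weak gradient `gv`: the closure of `C_c^∞(Ω; ℝ^d)` in `H¹(Ω; ℝ^d)`. -/
structure MemH10 {d : ℕ} (Ω : Set (Space d)) (v : Space d → Space d) (gv : Space d → Mat d) :
    Prop where
  memH1 : MemH1 Ω v gv
  approx : ∀ ε : ℝ, 0 < ε → ∃ φ : Space d → Space d,
    ContDiff ℝ (⊤ : ℕ∞) φ ∧ HasCompactSupport φ ∧ tsupport φ ⊆ Ω ∧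
    (∫ x in Ω, ‖v x - φ x‖ ^ 2) + (∫ x in Ω, normSq (gv x - gradient φ x)) < ε

/-! ### Weak solutions for stiff inclusions -/

/-- The vector field with gradient `gu` is rigid on the inclusions in `Ω`: its symmetric gradient
vanishes almost everywhere in `Ω ∩ F`. -/
def RigidOnInclusions {d : ℕ} (ω Ω : Set (Space d)) (gu : Space d → Mat d) : Prop :=
  ∀ᵐ x ∂(volume.restrict (Ω ∩ inclusions ω)), symPart (gu x) = 0

/-- `u ∈ H¹(Ω; ℝ^d)`, with weak gradient `gu`, is a weak solution of `𝓛_∞ (u) = 0` in `Ω`. -/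
structure IsStiffSolution {d : ℕ} (ω : Set (Space d)) (A : Space d → Tensor d)
    (Ω : Set (Space d)) (u : Space d → Space d) (gu : Space d → Mat d) : Prop where
  memH1 : MemH1 Ω u gu
  rigid : RigidOnInclusions ω Ω gu
  equation : ∀ (v : Space d → Space d) (gv : Space d → Mat d),
    MemH10 Ω v gv → RigidOnInclusions ω Ω gv →
      ∫ x in Ω ∩ ω, contract (A x) (gu x) (gv x) = 0

end

end StiffInclusion

namespace StiffInclusion

open Metric Set Topology
open scoped Convolution

/-! The obstacle to the usual Caccioppoli argument is that `η² u` is an admissible test field only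
if it is rigid on the inclusions, which fails for a generic cutoff `η`. The remedy is a cutoff that
is locally constant on the inclusions and still satisfies `|∇η| ≤ C / R`. Periodicity and
compactness bound the size of the inclusions uniformly, and they are uniformly separated. A
Lipschitz ramp at scale `R` can therefore be frozen near each inclusion at its value in one
representative point, which changes it by `O(1 / R)`. Mollifying below the separation scale makes it
smooth, keeps it constant near each inclusion, and costs a gradient of order `1 / R`
(`exists_cutoff`).

Testing with `η² u` and completing the square gives equality on `ω` of the energies of `∇(η u)` and
`∇η ⊗ u`. Ellipticity then bounds `D(η u)` on `ω`; on the inclusions `D(η u) = 0`, and their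
boundaries are null. Korn's first inequality in `H¹₀` recovers the full gradient.

For `R ≥ R₀` this gives the estimate without the last term. For `32 ≤ R < R₀` the last term alone
dominates, since `R₀ ^ (2 * l) / R ^ (2 * l) ≥ 1`. -/

/-! ### Uniform separation and uniform size of the inclusions. -/

theorem IsMatrixWithInclusions.exists_pos_le_dist_closure {d : ℕ} {ω : Set (Space d)}
    {Fs : Set (Set (Space d))} (h : IsMatrixWithInclusions ω Fs) :
    ∃ c : ℝ, 0 < c ∧ ∀ F ∈ Fs, ∀ G ∈ Fs, F ≠ G →
      ∀ x ∈ closure F, ∀ y ∈ closure G, c ≤ dist x y := by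
  obtain ⟨c, hc, H⟩ := h.dist_pos
  refine ⟨c, hc, fun F hF G hG hne x hx y hy => ?_⟩
  by_contra! hlt
  obtain ⟨x', hx', hxx⟩ := Metric.mem_closure_iff.1 hx ((c - dist x y) / 2) (by linarith)
  obtain ⟨y', hy', hyy⟩ := Metric.mem_closure_iff.1 hy ((c - dist x y) / 2) (by linarith)
  have := H F hF G hG hne x' hx' y' hy'
  have h1 := dist_triangle x' x y'
  have h2 := dist_triangle x y y'
  rw [dist_comm] at hxx
  linarith

/-- Points closer than the separation lie in the closure of the same inclusion, which is connected.
Components of `ωᶜ` stand in for the family `Fs` because they are determined by `ω` and so move with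
the lattice translations. -/
theorem IsMatrixWithInclusions.connectedComponentIn_eq {d : ℕ} {ω : Set (Space d)}
    {Fs : Set (Set (Space d))} (h : IsMatrixWithInclusions ω Fs) :
    ∃ c : ℝ, 0 < c ∧ ∀ p ∈ ωᶜ, ∀ q ∈ ωᶜ, dist p q < c →
      connectedComponentIn ωᶜ p = connectedComponentIn ωᶜ q := by
  obtain ⟨c, hc, H⟩ := h.exists_pos_le_dist_closure
  refine ⟨c, hc, fun p hp q hq hpq => ?_⟩
  rw [h.compl_eq] at hp hq
  simp only [mem_iUnion, exists_prop] at hp hq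
  obtain ⟨F, hF, hpF⟩ := hp
  obtain ⟨G, hG, hqG⟩ := hq
  have hFG : F = G := by
    by_contra hne
    exact absurd (H F hF G hG hne p hpF q hqG) (not_le.2 hpq)
  subst hFG
  refine _root_.connectedComponentIn_eq ?_
  refine ((h.domain F hF).isConnected.isPreconnected.closure.subset_connectedComponentIn hpF ?_) hqG
  rw [h.compl_eq]
  exact subset_biUnion_of_mem (u := fun F => closure F) hF

/-- The `c / 2`-neighbourhoods of one closed inclusion and of all the others are disjoint open sets
covering `ωᶜ`, so a component cannot leave the first. -/
theorem IsMatrixWithInclusions.isBounded_connectedComponentIn {d : ℕ} {ω : Set (Space d)}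
    {Fs : Set (Set (Space d))} (h : IsMatrixWithInclusions ω Fs) {p : Space d} (hp : p ∈ ωᶜ) :
    Bornology.IsBounded (connectedComponentIn ωᶜ p) := by
  obtain ⟨c, hc, H⟩ := h.exists_pos_le_dist_closure
  have hp' := hp
  rw [h.compl_eq] at hp'
  simp only [mem_iUnion, exists_prop] at hp'
  obtain ⟨F, hF, hpF⟩ := hp'
  have hsub : connectedComponentIn ωᶜ p ⊆ thickening (c / 2) (closure F) := by
    refine isPreconnected_connectedComponentIn.subset_left_of_subset_union
      (v := ⋃ G ∈ Fs \ {F}, thickening (c / 2) (closure G)) isOpen_thickening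
      (isOpen_biUnion fun _ _ => isOpen_thickening) ?_ ?_
      ⟨p, mem_connectedComponentIn hp, self_subset_thickening (by positivity) _ hpF⟩
    · rw [Set.disjoint_left]
      intro x hx hx'
      simp only [mem_iUnion, exists_prop] at hx'
      obtain ⟨G, hG, hxG⟩ := hx'
      obtain ⟨a, ha, hxa⟩ := mem_thickening_iff.1 hx
      obtain ⟨b, hb, hxb⟩ := mem_thickening_iff.1 hxG
      have := H F hF G hG.1 (fun e => hG.2 e.symm) a ha b hb
      have := dist_triangle_left a b x
      linarith
    · refine (connectedComponentIn_subset _ _).trans ?_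
      rw [h.compl_eq]
      refine iUnion₂_subset fun G hG => ?_
      by_cases e : G = F
      · subst e
        exact (self_subset_thickening (by positivity) _).trans subset_union_left
      · refine (self_subset_thickening (δ := c / 2) (by positivity) _).trans ?_
        exact (subset_biUnion_of_mem (u := fun G => thickening (c / 2) (closure G))
          (show G ∈ Fs \ {F} from ⟨hG, e⟩)).trans subset_union_right
  exact ((h.domain F hF).isBounded.closure.thickening).subset hsub

theorem IsMatrixWithInclusions.connectedComponentIn_add_intVec {d : ℕ} {ω : Set (Space d)}
    {Fs : Set (Set (Space d))} (h : IsMatrixWithInclusions ω Fs) {p : Space d} (hp : p ∈ ωᶜ)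
    (z : Fin d → ℤ) :
    connectedComponentIn ωᶜ (p + intVec z) =
      (fun x => x + intVec z) '' connectedComponentIn ωᶜ p := by
  have := (Homeomorph.addRight (intVec z)).image_connectedComponentIn hp
  simp only [Homeomorph.coe_addRight] at this
  rw [this]
  congr 1
  ext x
  simp only [mem_image, mem_compl_iff]
  constructor
  · intro hx
    refine ⟨x - intVec z, ?_, by simp⟩
    rw [← h.periodic z]
    simpa using hx
  · rintro ⟨y, hy, rfl⟩
    rwa [h.periodic z]

theorem exists_norm_add_intVec_le {d : ℕ} (x : Space d) :
    ∃ z : Fin d → ℤ, ‖x + intVec z‖ ≤ d := by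
  refine ⟨fun i => -⌊x i⌋, ?_⟩
  have hc : ∀ i, (x + intVec (fun i => -⌊x i⌋)) i = Int.fract (x i) := by
    intro i
    simp [intVec, Int.fract, sub_eq_add_neg]
  rw [EuclideanSpace.norm_eq]
  refine Real.sqrt_le_iff.2 ⟨by positivity, ?_⟩
  calc _ ≤ ∑ i : Fin d, (1 : ℝ) := by
        refine Finset.sum_le_sum fun i _ => ?_
        rw [hc, Real.norm_eq_abs, sq_abs]
        have h0 := Int.fract_nonneg (x i)
        have h1 := (Int.fract_lt_one (x i)).le
        nlinarith
    _ = d := by simp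
    _ ≤ (d : ℝ) ^ 2 := by
        rcases Nat.eq_zero_or_pos d with rfl | hd
        · simp
        · have : (1 : ℝ) ≤ d := by exact_mod_cast hd
          nlinarith

/-- Nearby points share their component, so a bound at one point extends to a neighbourhood;
compactness makes it uniform on a ball that meets every lattice orbit, and periodicity carries it
everywhere. -/
theorem IsMatrixWithInclusions.exists_connectedComponentIn_subset_closedBall {d : ℕ}
    {ω : Set (Space d)} {Fs : Set (Set (Space d))} (h : IsMatrixWithInclusions ω Fs) :
    ∃ M : ℝ, 0 ≤ M ∧ ∀ p ∈ ωᶜ, connectedComponentIn ωᶜ p ⊆ closedBall p M := by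
  obtain ⟨c, hc, hloc⟩ := h.connectedComponentIn_eq
  have key : ∃ M : ℝ, ∀ p ∈ closedBall (0 : Space d) d ∩ ωᶜ,
      connectedComponentIn ωᶜ p ⊆ closedBall p M := by
    have hK : IsCompact (closedBall (0 : Space d) d ∩ ωᶜ) :=
      (isCompact_closedBall _ _).inter_right h.isOpen.isClosed_compl
    refine hK.induction_on (p := fun S => ∃ M : ℝ, ∀ p ∈ S,
      connectedComponentIn ωᶜ p ⊆ closedBall p M) ⟨0, by simp⟩ ?_ ?_ ?_
    · rintro S T hST ⟨M, hM⟩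
      exact ⟨M, fun p hp => hM p (hST hp)⟩
    · rintro S T ⟨M, hM⟩ ⟨N, hN⟩
      refine ⟨max M N, fun p hp => ?_⟩
      rcases hp with hp | hp
      · exact (hM p hp).trans (closedBall_subset_closedBall (le_max_left _ _))
      · exact (hN p hp).trans (closedBall_subset_closedBall (le_max_right _ _))
    · intro x hx
      obtain ⟨M, hM⟩ := (h.isBounded_connectedComponentIn hx.2).subset_closedBall x
      refine ⟨ball x c ∩ (closedBall (0 : Space d) d ∩ ωᶜ), ?_, M + c, fun p hp => ?_⟩
      · rw [inter_comm (ball x c)]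
        exact inter_mem_nhdsWithin _ (ball_mem_nhds x hc)
      · rw [hloc p hp.2.2 x hx.2 hp.1]
        refine hM.trans (closedBall_subset_closedBall' ?_)
        have := mem_ball'.1 hp.1
        linarith
  obtain ⟨M, hM⟩ := key
  refine ⟨max M 0, le_max_right _ _, fun p hp => ?_⟩
  obtain ⟨z, hz⟩ := exists_norm_add_intVec_le p
  have hp' : p + intVec z ∈ ωᶜ := by rwa [mem_compl_iff, h.periodic z]
  have := hM (p + intVec z) ⟨by simpa using hz, hp'⟩
  rw [h.connectedComponentIn_add_intVec hp z] at this
  intro x hx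
  have hx' := this ⟨x, hx, rfl⟩
  simp only [mem_closedBall, dist_add_right] at hx' ⊢
  exact hx'.trans (le_max_left _ _)

/-- A choice of one point in each inclusion: nearby points of the inclusions have the same
representative, and representatives are at bounded distance. -/
theorem IsMatrixWithInclusions.exists_representative {d : ℕ}
    {ω : Set (Space d)} {Fs : Set (Set (Space d))} (h : IsMatrixWithInclusions ω Fs) :
    ∃ (c M : ℝ) (rep : Space d → Space d), 0 < c ∧ 0 ≤ M ∧
      (∀ p ∈ ωᶜ, ∀ q ∈ ωᶜ, dist p q < c → rep p = rep q) ∧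
      ∀ p ∈ ωᶜ, dist (rep p) p ≤ M := by
  classical
  obtain ⟨c, hc, hloc⟩ := h.connectedComponentIn_eq
  obtain ⟨M, hM0, hM⟩ := h.exists_connectedComponentIn_subset_closedBall
  -- The choice depends on the component as a set only, so equal components get the same point. The
  -- value `0` is never used at points of `ωᶜ`.
  let pick : Set (Space d) → Space d := fun S => if hS : S.Nonempty then hS.some else 0
  refine ⟨c, M, fun p => pick (connectedComponentIn ωᶜ p), hc, hM0, ?_, ?_⟩
  · intro p hp q hq hpq
    simp only [hloc p hp q hq hpq]
  · intro p hp
    have hne : (connectedComponentIn ωᶜ p).Nonempty := ⟨p, mem_connectedComponentIn hp⟩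
    have : pick (connectedComponentIn ωᶜ p) = hne.some := dif_pos hne
    simp only [this]
    exact hM p hp hne.some_mem

/-! ### The boundaries of the inclusions are null sets. -/

/-- A set on which a measurable function that grows linearly in a direction takes a fixed value
is a null set. -/
theorem volume_level_set_eq_zero {d : ℕ} {h : Space d → ℝ} (hm : Measurable h) {n : Space d}
    (ht : ∀ (x : Space d) (t : ℝ), h (x + t • n) = h x + t) (s : ℝ) :
    volume {x | h x = s} = 0 := by
  have hcount := Measure.countable_meas_level_set_pos (μ := (volume : Measure (Space d))) hm
  by_contra hne
  -- All level sets are translates of each other. If one had positive measure, all would, but only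
  -- countably many can.
  have hall : ∀ t : ℝ, t ∈ {t : ℝ | 0 < volume {a : Space d | h a = t}} := by
    intro t
    have : {x : Space d | h x = s} = (fun x => x + (t - s) • n) ⁻¹' {x | h x = t} := by
      ext x
      simp only [mem_ofPred_eq, mem_preimage, ht]
      constructor <;> intro e <;> linarith
    rw [this, measure_preimage_add_right] at hne
    exact pos_iff_ne_zero.2 hne
  have : (univ : Set ℝ).Countable := hcount.mono fun t _ => hall t
  exact Cardinal.not_countable_real this

/-- Near `p` the frontier lies in the zero set of the height above the graph, a continuous function
that grows at unit rate along `n`. -/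
theorem IsLipschitzGraphAt.exists_volume_frontier_inter_ball {d : ℕ} {F : Set (Space d)}
    {p : Space d} (h : IsLipschitzGraphAt F p) :
    ∃ r : ℝ, 0 < r ∧ volume (frontier F ∩ ball p r) = 0 := by
  obtain ⟨r, n, γ, K, hr, hn, hγ, H⟩ := h
  refine ⟨r, hr, ?_⟩
  let g : Space d → ℝ := fun x => inner ℝ x n - γ (x - inner ℝ x n • n)
  have hg : Continuous g := by
    have := hγ.continuous
    fun_prop
  refine measure_mono_null (t := {x | g x = 0}) ?_
    (volume_level_set_eq_zero hg.measurable (n := n) ?_ 0)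
  · rintro x ⟨hxF, hx⟩
    rcases lt_trichotomy (g x) 0 with hlt | heq | hgt
    · have hnhds : ∀ᶠ y in 𝓝 x, y ∈ Fᶜ := by
        filter_upwards [hg.continuousAt.eventually_lt continuousAt_const hlt,
          isOpen_ball.mem_nhds hx] with y hy hyb
        rw [mem_compl_iff, H y hyb]
        simp only [g] at hy
        linarith
      have hint : x ∈ interior Fᶜ := mem_interior_iff_mem_nhds.2 hnhds
      rw [interior_compl] at hint
      exact absurd hxF.1 hint
    · exact heq
    · have hnhds : ∀ᶠ y in 𝓝 x, y ∈ F := by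
        filter_upwards [continuousAt_const.eventually_lt hg.continuousAt hgt,
          isOpen_ball.mem_nhds hx] with y hy hyb
        rw [H y hyb]
        simp only [g] at hy
        linarith
      exact absurd (mem_interior_iff_mem_nhds.2 hnhds) hxF.2
  · intro x t
    have h1 : inner ℝ (x + t • n) n = inner ℝ x n + t := by
      rw [inner_add_left, inner_smul_left, real_inner_self_eq_norm_sq, hn]; simp
    simp only [g, h1]
    have h2 : x + t • n - (inner ℝ x n + t) • n = x - inner ℝ x n • n := by module
    rw [h2]; ring

theorem IsBoundedLipschitzDomain.volume_frontier {d : ℕ} {F : Set (Space d)}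
    (h : IsBoundedLipschitzDomain F) : volume (frontier F) = 0 := by
  refine measure_null_of_locally_null _ fun p hp => ?_
  obtain ⟨r, hr, h0⟩ := (h.lipschitz p hp).exists_volume_frontier_inter_ball
  exact ⟨_, inter_mem_nhdsWithin _ (ball_mem_nhds p hr), h0⟩

/-- The equation lives on `ω` and the rigidity on the complement of its closure; what is left over
is covered by the frontiers of the inclusions. These are countably many, being disjoint nonempty
open sets. -/
theorem IsMatrixWithInclusions.volume_compl_diff_inclusions {d : ℕ}
    {ω : Set (Space d)} {Fs : Set (Set (Space d))} (h : IsMatrixWithInclusions ω Fs) :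
    volume (ωᶜ \ inclusions ω) = 0 := by
  have hcount : Fs.Countable := by
    refine Set.PairwiseDisjoint.countable_of_isOpen (s := fun F : Set (Space d) => F) (a := Fs) ?_
      (fun F hF => (h.domain F hF).isOpen) (fun F hF => (h.domain F hF).isConnected.nonempty)
    intro F hF G hG hne
    exact (h.disjoint F hF G hG hne).mono subset_closure subset_closure
  refine measure_mono_null (t := ⋃ F ∈ Fs, frontier F) ?_
    ((measure_biUnion_null_iff hcount).2 fun F hF => (h.domain F hF).volume_frontier)
  rintro x ⟨hx, hxi⟩
  rw [h.compl_eq] at hx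
  simp only [mem_iUnion, exists_prop] at hx ⊢
  obtain ⟨F, hF, hxF⟩ := hx
  refine ⟨F, hF, hxF, fun hint => hxi ?_⟩
  have hsub : F ⊆ ωᶜ := by
    rw [h.compl_eq]
    exact subset_closure.trans (subset_biUnion_of_mem (u := fun F => closure F) hF)
  rw [inclusions, ← interior_compl]
  exact interior_mono hsub hint

/-! ### Cutoff functions that are constant near each inclusion. -/

/-- A Lipschitz profile equal to `1` where `maxᵢ |xᵢ| ≤ 5R/16` and to `0` where it is at least
`7R/16`. -/
noncomputable def rampCutoff (d : ℕ) (R : ℝ) (x : Space d) : ℝ :=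
  max 0 (min 1 (7 / 2 - 8 / R * ‖WithLp.ofLp x‖))

theorem rampCutoff_nonneg (d : ℕ) (R : ℝ) (x : Space d) : 0 ≤ rampCutoff d R x := le_max_left _ _

theorem rampCutoff_le_one (d : ℕ) (R : ℝ) (x : Space d) : rampCutoff d R x ≤ 1 :=
  max_le zero_le_one (min_le_left _ _)

theorem rampCutoff_eq_one {d : ℕ} {R : ℝ} (hR : 0 < R) {x : Space d}
    (hx : ‖WithLp.ofLp x‖ ≤ 5 * R / 16) : rampCutoff d R x = 1 := by
  have : 8 / R * ‖WithLp.ofLp x‖ ≤ 5 / 2 := by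
    rw [div_mul_eq_mul_div, div_le_iff₀ hR]; linarith
  rw [rampCutoff, min_eq_left (by linarith), max_eq_right zero_le_one]

theorem rampCutoff_eq_zero {d : ℕ} {R : ℝ} (hR : 0 < R) {x : Space d}
    (hx : 7 * R / 16 ≤ ‖WithLp.ofLp x‖) : rampCutoff d R x = 0 := by
  have : 7 / 2 ≤ 8 / R * ‖WithLp.ofLp x‖ := by
    rw [div_mul_eq_mul_div, le_div_iff₀ hR]; linarith
  rw [rampCutoff, max_eq_left]
  exact (min_le_right _ _).trans (by linarith)

theorem norm_ofLp_le {d : ℕ} (x : Space d) : ‖WithLp.ofLp x‖ ≤ ‖x‖ :=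
  (pi_norm_le_iff_of_nonneg (norm_nonneg x)).2 fun i => PiLp.norm_apply_le x i

theorem abs_rampCutoff_sub_le {d : ℕ} {R : ℝ} (hR : 0 < R) (x y : Space d) :
    |rampCutoff d R x - rampCutoff d R y| ≤ 8 / R * dist x y := by
  have h1 := abs_max_sub_max_le_max 0 (min 1 (7 / 2 - 8 / R * ‖WithLp.ofLp x‖))
    0 (min 1 (7 / 2 - 8 / R * ‖WithLp.ofLp y‖))
  have h2 := abs_min_sub_min_le_max 1 (7 / 2 - 8 / R * ‖WithLp.ofLp x‖)
    1 (7 / 2 - 8 / R * ‖WithLp.ofLp y‖)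
  rw [sub_self, abs_zero, max_eq_right (a := (0 : ℝ)) (b := |_|) (abs_nonneg _)] at h1 h2
  refine h1.trans (h2.trans ?_)
  have h3 : 7 / 2 - 8 / R * ‖WithLp.ofLp x‖ - (7 / 2 - 8 / R * ‖WithLp.ofLp y‖) =
      8 / R * (‖WithLp.ofLp y‖ - ‖WithLp.ofLp x‖) := by ring
  rw [h3, abs_mul, abs_of_pos (by positivity : 0 < 8 / R)]
  refine mul_le_mul_of_nonneg_left ?_ (by positivity)
  refine (abs_norm_sub_norm_le _ _).trans ?_
  rw [dist_comm, dist_eq_norm, ← WithLp.ofLp_sub]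
  exact norm_ofLp_le _

theorem continuous_rampCutoff (d : ℕ) (R : ℝ) : Continuous (rampCutoff d R) := by
  have : Continuous fun x : Space d => ‖WithLp.ofLp x‖ := (PiLp.continuous_ofLp 2 _).norm
  unfold rampCutoff
  fun_prop

theorem mem_cube_iff_norm_ofLp_lt {d : ℕ} {R : ℝ} (hR : 0 < R) {x : Space d} :
    x ∈ cube d R ↔ ‖WithLp.ofLp x‖ < R / 2 := by
  rw [pi_norm_lt_iff (by positivity)]
  simp only [cube, mem_ofPred_eq, Real.norm_eq_abs, abs_lt]

theorem isOpen_cube (d : ℕ) (R : ℝ) : IsOpen (cube d R) := by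
  simp only [cube, ofPred_forall]
  refine isOpen_iInter_of_finite fun i => ?_
  have hi : Continuous fun x : Space d => x i := by fun_prop
  exact (isOpen_lt continuous_const hi).inter (isOpen_lt hi continuous_const)

theorem isCompact_setOf_norm_ofLp_le (d : ℕ) (r : ℝ) :
    IsCompact {x : Space d | ‖WithLp.ofLp x‖ ≤ r} := by
  have : {x : Space d | ‖WithLp.ofLp x‖ ≤ r} =
      (PiLp.homeomorph 2 fun _ : Fin d => ℝ) ⁻¹' closedBall 0 r := by
    ext x; simp [PiLp.homeomorph]
  rw [this]
  exact (Homeomorph.isCompact_preimage _).2 (isCompact_closedBall _ _)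

/-- A continuous function has a measurable modification, at bounded distance, that is constant near
each inclusion. -/
theorem IsMatrixWithInclusions.exists_locally_constant_modification {d : ℕ} {ω : Set (Space d)}
    {Fs : Set (Set (Space d))} (h : IsMatrixWithInclusions ω Fs) :
    ∃ (c M : ℝ), 0 < c ∧ 0 ≤ M ∧ ∀ f : Space d → ℝ, Continuous f →
      ∃ g : Space d → ℝ, Measurable g ∧ (∀ x, ∃ y, dist x y ≤ M ∧ g x = f y) ∧
        ∀ p ∈ ωᶜ, ∀ q ∈ ωᶜ, dist p q < c → ∀ x ∈ ball p c, ∀ y ∈ ball q c, g x = g y := by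
  classical
  obtain ⟨c, M, rep, hc, hM, hrep, hdist⟩ := h.exists_representative
  -- Two points of `ωᶜ` within `c / 3` of a common point are less than `c` apart, so the frozen
  -- value does not depend on which nearby point is chosen.
  have hc3 : 0 < c / 3 := by positivity
  refine ⟨c / 3, M + c / 3, hc3, by positivity, fun f hf => ?_⟩
  set U := thickening (c / 3) ωᶜ with hU
  have hmem : ∀ x ∈ U, ∃ p ∈ ωᶜ, dist x p < c / 3 := fun x hx => mem_thickening_iff.1 hx
  choose! near hnear hnear' using hmem
  have hconst : ∀ p ∈ ωᶜ, ∀ x ∈ ball p (c / 3), x ∈ U ∧ rep (near x) = rep p := by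
    intro p hp x hx
    have hxU : x ∈ U := mem_thickening_iff.2 ⟨p, hp, hx⟩
    refine ⟨hxU, hrep _ (hnear x hxU) _ hp ?_⟩
    have h1 := hnear' x hxU
    have h2 := mem_ball.1 hx
    have h3 := dist_triangle_left (near x) p x
    linarith
  let g : Space d → ℝ := U.piecewise (fun x => f (rep (near x))) f
  have hgU : ∀ x ∈ U, g x = f (rep (near x)) := fun x hx => piecewise_eq_of_mem _ _ _ hx
  refine ⟨g, ?_, ?_, ?_⟩
  -- On the open set `U` the modification is locally constant, although `near` itself is an
  -- arbitrary choice.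
  · refine ContinuousOn.measurable_piecewise ?_ hf.continuousOn isOpen_thickening.measurableSet
    intro x hx
    refine ContinuousAt.continuousWithinAt ?_
    refine continuousAt_const (y := f (rep (near x))) |>.congr ?_
    filter_upwards [isOpen_ball.mem_nhds (mem_ball.2 (hnear' x hx))] with y hy
    rw [(hconst _ (hnear x hx) y hy).2, (hconst _ (hnear x hx) x (mem_ball.2 (hnear' x hx))).2]
  · intro x
    by_cases hx : x ∈ U
    · refine ⟨rep (near x), ?_, hgU x hx⟩
      have h1 := hnear' x hx
      have h2 := hdist (near x) (hnear x hx)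
      have h3 := dist_triangle x (near x) (rep (near x))
      rw [dist_comm (near x)] at h3
      linarith
    · exact ⟨x, by rw [dist_self]; positivity, piecewise_eq_of_notMem _ _ _ hx⟩
  · intro p hp q hq hpq x hx y hy
    obtain ⟨hxU, hx'⟩ := hconst p hp x hx
    obtain ⟨hyU, hy'⟩ := hconst q hq y hy
    rw [hgU x hxU, hgU y hyU, hx', hy', hrep p hp q hq (by linarith)]

/-- The gradient of a mollification is controlled by the oscillation at the scale of the
mollifier. -/
theorem exists_norm_fderiv_convolution_le {d : ℕ} (φ : ContDiffBump (0 : Space d)) :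
    ∃ B : ℝ, 0 ≤ B ∧ ∀ g : Space d → ℝ, LocallyIntegrable g volume → ∀ (x : Space d) (δ : ℝ),
      0 ≤ δ → (∀ y ∈ ball x (2 * φ.rOut), |g y - g x| ≤ δ) →
      ‖fderiv ℝ (φ.normed volume ⋆[ContinuousLinearMap.lsmul ℝ ℝ, volume] g) x‖ ≤ B * δ := by
  set ρ := φ.normed (volume : Measure (Space d)) with hρ
  have hρs : HasCompactSupport ρ := φ.hasCompactSupport_normed
  have hρd : ContDiff ℝ 1 ρ := φ.contDiff_normed
  obtain ⟨L, hL⟩ := hρd.lipschitzWith_of_hasCompactSupport hρs one_ne_zero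
  set r := φ.rOut with hr
  have hrpos : 0 < r := φ.rOut_pos
  refine ⟨L * volume.real (ball (0 : Space d) (2 * r)), by positivity, ?_⟩
  intro g hg x δ hδ hosc
  have hconv : ∀ z : Space d, Integrable (fun y => ρ (z - y) * g y) volume := by
    intro z
    have := (hρs.convolutionExists_left (ContinuousLinearMap.lsmul ℝ ℝ)
      φ.continuous_normed hg z).integrable_swap
    simpa [ContinuousLinearMap.flip_apply, mul_comm] using this
  have hρi : ∀ z : Space d, Integrable (fun y => ρ (z - y)) volume := fun z =>
    (φ.integrable_normed (μ := volume)).comp_sub_left z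
  have hρ1 : ∀ z : Space d, ∫ y, ρ (z - y) = 1 := fun z => by
    rw [integral_sub_left_eq_self ρ volume z]; exact φ.integral_normed
  have hval : ∀ z : Space d, (ρ ⋆[ContinuousLinearMap.lsmul ℝ ℝ, volume] g) z - g x =
      ∫ y, ρ (z - y) * (g y - g x) := by
    intro z
    simp_rw [mul_sub]
    rw [integral_sub (hconv z) ((hρi z).mul_const _), integral_mul_const, hρ1, one_mul,
      convolution_eq_swap]
    rfl
  have hdi : ∀ z : Space d, Integrable (fun y => ρ (z - y) * (g y - g x)) volume := fun z => by
    simp_rw [mul_sub]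
    exact (hconv z).sub ((hρi z).mul_const _)
  refine norm_fderiv_le_of_lip' ℝ (by positivity) ?_
  filter_upwards [ball_mem_nhds x hrpos] with z hz
  -- Both translated kernels have mass one, so the constant `g x` can be subtracted from `g`; both
  -- are supported in the ball of radius `2 * r` about `x`.
  have hdiff : (ρ ⋆[ContinuousLinearMap.lsmul ℝ ℝ, volume] g) z -
      (ρ ⋆[ContinuousLinearMap.lsmul ℝ ℝ, volume] g) x =
      ∫ y in ball x (2 * r), (ρ (z - y) - ρ (x - y)) * (g y - g x) := by
    rw [setIntegral_eq_integral_of_forall_compl_eq_zero]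
    · simp_rw [sub_mul]
      rw [integral_sub (hdi z) (hdi x), ← hval, ← hval]
      ring
    · intro y hy
      have hzero : ∀ w : Space d, dist w x < r → ρ (w - y) = 0 := by
        intro w hw
        rw [← Function.notMem_support, hρ, φ.support_normed_eq]
        intro hmem
        rw [mem_ball_zero_iff, ← dist_eq_norm] at hmem
        refine hy (mem_ball.2 ?_)
        have := dist_triangle_left y x w
        linarith
      rw [hzero z hz, hzero x (by simpa using hrpos)]
      ring
  rw [hdiff]
  have hvol : volume (ball x (2 * r)) < ⊤ := measure_ball_lt_top
  refine (norm_setIntegral_le_of_norm_le_const hvol (C := L * ‖z - x‖ * δ) ?_).trans ?_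
  · intro y hy
    rw [norm_mul]
    refine mul_le_mul ?_ (hosc y hy) (norm_nonneg _) (by positivity)
    have := hL.dist_le_mul (z - y) (x - y)
    rwa [dist_sub_right, dist_eq_norm, dist_eq_norm] at this
  · have : volume.real (ball x (2 * r)) = volume.real (ball (0 : Space d) (2 * r)) := by
      simp only [Measure.real, Measure.addHaar_ball_center]
    rw [this]
    exact le_of_eq (by ring)

/-- Cutoff functions at scale `R` that are locally constant on the inclusions. -/
theorem IsMatrixWithInclusions.exists_cutoff {d : ℕ} {ω : Set (Space d)}
    {Fs : Set (Set (Space d))} (h : IsMatrixWithInclusions ω Fs) :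
    ∃ R₀ C : ℝ, 0 < R₀ ∧ 0 ≤ C ∧ ∀ R : ℝ, R₀ ≤ R → ∃ η : Space d → ℝ,
      ContDiff ℝ (⊤ : ℕ∞) η ∧ HasCompactSupport η ∧ tsupport η ⊆ cube d R ∧
      (∀ x ∈ cube d (R / 2), η x = 1) ∧ (∀ x, ‖fderiv ℝ η x‖ ≤ C / R) ∧
      ∀ x ∈ inclusions ω, fderiv ℝ η x = 0 := by
  obtain ⟨c, M, hc, hM, hmod⟩ := h.exists_locally_constant_modification
  -- The outer radius `c / 2` keeps the mollifier inside the balls of radius `c` on which `g` is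
  -- constant, and makes `c` the oscillation scale `2 * φ.rOut`.
  let φ : ContDiffBump (0 : Space d) := ⟨c / 4, c / 2, by positivity, by linarith⟩
  have hφr : φ.rOut = c / 2 := rfl
  obtain ⟨B, hB, hgrad⟩ := exists_norm_fderiv_convolution_le φ
  -- This lower bound on `R` gives `M + c < R / 16`, the room between the ramp, which lives in
  -- `5R/16 ≤ ‖x‖ ≤ 7R/16`, and both `R / 4` and `R / 2`. Over distance `c`, `g` varies by at most
  -- `8 / R * (2 * M + c)`: two displacements by `M` and the slope `8 / R`.
  refine ⟨32 * (M + c), B * (8 * (2 * M + c)), by positivity, by positivity, fun R hR => ?_⟩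
  have hRpos : 0 < R := lt_of_lt_of_le (by positivity) hR
  obtain ⟨g, hgm, hgf, hgc⟩ := hmod (rampCutoff d R) (continuous_rampCutoff d R)
  have hg0 : ∀ x, 0 ≤ g x := fun x => by
    obtain ⟨y, -, e⟩ := hgf x
    rw [e]; exact rampCutoff_nonneg _ _ _
  have hg1 : ∀ x, g x ≤ 1 := fun x => by
    obtain ⟨y, -, e⟩ := hgf x
    rw [e]; exact rampCutoff_le_one _ _ _
  have hgli : LocallyIntegrable g volume := by
    refine (locallyIntegrable_const (1 : ℝ)).mono hgm.aestronglyMeasurable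
      (Filter.Eventually.of_forall fun x => ?_)
    rw [Real.norm_of_nonneg (hg0 x), norm_one]
    exact hg1 x
  have hnorm : ∀ x y : Space d, ‖WithLp.ofLp y‖ ≤ ‖WithLp.ofLp x‖ + dist x y := by
    intro x y
    have h1 := norm_ofLp_le (y - x)
    have h2 := norm_le_norm_add_norm_sub' (WithLp.ofLp y) (WithLp.ofLp x)
    rw [WithLp.ofLp_sub] at h1
    rw [dist_comm, dist_eq_norm]
    linarith
  have hgone : ∀ x : Space d, ‖WithLp.ofLp x‖ ≤ 5 * R / 16 - M → g x = 1 := by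
    intro x hx
    obtain ⟨y, hy, e⟩ := hgf x
    rw [e]
    exact rampCutoff_eq_one hRpos (by linarith [hnorm x y])
  have hgzero : ∀ x : Space d, 7 * R / 16 + M ≤ ‖WithLp.ofLp x‖ → g x = 0 := by
    intro x hx
    obtain ⟨y, hy, e⟩ := hgf x
    rw [e]
    refine rampCutoff_eq_zero hRpos ?_
    have := hnorm y x
    rw [dist_comm] at this
    linarith
  set η := φ.normed volume ⋆[ContinuousLinearMap.lsmul ℝ ℝ, volume] g with hη
  have hηconst : ∀ x a, (∀ y ∈ ball x c, g y = a) → η x = a := by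
    intro x a ha
    have hx : g x = a := ha x (mem_ball_self hc)
    rw [hη, φ.normed_convolution_eq_right, hx]
    intro y hy
    rw [hx]
    refine ha y (ball_subset_ball ?_ hy)
    rw [hφr]; linarith
  have hsupp : Function.support η ⊆ {x : Space d | ‖WithLp.ofLp x‖ ≤ 7 * R / 16 + M + c} := by
    intro x hx
    by_contra hlt
    simp only [mem_ofPred_eq, not_le] at hlt
    refine hx (hηconst x 0 fun y hy => hgzero y ?_)
    have := hnorm y x
    have := mem_ball.1 hy
    linarith
  have hcomp := isCompact_setOf_norm_ofLp_le d (7 * R / 16 + M + c)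
  have htsupp : tsupport η ⊆ {x : Space d | ‖WithLp.ofLp x‖ ≤ 7 * R / 16 + M + c} :=
    closure_minimal hsupp hcomp.isClosed
  refine ⟨η, ?_, ?_, ?_, ?_, ?_, ?_⟩
  · exact φ.hasCompactSupport_normed.contDiff_convolution_left _ φ.contDiff_normed hgli
  · exact hcomp.of_isClosed_subset (isClosed_tsupport η) htsupp
  · intro x hx
    have := htsupp hx
    rw [mem_ofPred_eq] at this
    rw [mem_cube_iff_norm_ofLp_lt hRpos]
    linarith
  · intro x hx
    rw [mem_cube_iff_norm_ofLp_lt (by positivity)] at hx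
    refine hηconst x 1 fun y hy => hgone y ?_
    have := hnorm x y
    have := mem_ball'.1 hy
    linarith
  · intro x
    refine (hgrad g hgli x (8 / R * (2 * M + c)) (by positivity) fun y hy => ?_).trans
      (le_of_eq (by ring))
    obtain ⟨x', hx', ex⟩ := hgf x
    obtain ⟨y', hy', ey⟩ := hgf y
    rw [ex, ey]
    refine (abs_rampCutoff_sub_le hRpos y' x').trans
      (mul_le_mul_of_nonneg_left ?_ (by positivity))
    have h1 := dist_triangle4 y' y x x'
    rw [hφr] at hy
    have h2 := mem_ball.1 hy
    rw [dist_comm y' y] at h1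
    linarith
  · intro x hx
    have hopen : IsOpen (inclusions ω) := isClosed_closure.isOpen_compl
    have hsub : inclusions ω ⊆ ωᶜ := compl_subset_compl.2 subset_closure
    have hev : η =ᶠ[𝓝 x] fun _ => g x := by
      filter_upwards [hopen.mem_nhds hx, ball_mem_nhds x hc] with z hz hzx
      exact hηconst z _ fun y hy =>
        hgc z (hsub hz) x (hsub hx) hzx y hy x (mem_ball_self hc)
    rw [hev.fderiv_eq, fderiv_const_apply]

/-! ### Convergence of mollifications in `L²`. -/

/-- This is the continuity of translations in `L²`, read off from the continuous action of
`DomAddAct` on `Lp`. -/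
theorem exists_forall_integral_translate_sub_sq_lt {d : ℕ} {f : Space d → ℝ}
    (hf : MemLp f 2 volume) {ε : ℝ} (hε : 0 < ε) :
    ∃ δ > 0, ∀ t : Space d, ‖t‖ < δ → ∫ x, (f (x - t) - f x) ^ 2 < ε := by
  have : Fact ((2 : ENNReal) ≠ ⊤) := ⟨by simp⟩
  let F := hf.toLp f
  have hcont : Continuous fun t : Space d => (DomAddAct.mk (-t)) +ᵥ F := by
    have h1 : Continuous fun t : Space d => DomAddAct.mk (-t) :=
      DomAddAct.continuous_mk.comp continuous_neg
    exact h1.vadd continuous_const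
  have hsq : ∀ t : Space d, ‖(DomAddAct.mk (-t) +ᵥ F) - F‖ ^ 2 = ∫ x, (f (x - t) - f x) ^ 2 := by
    intro t
    rw [← real_inner_self_eq_norm_sq, L2.inner_def]
    refine integral_congr_ae ?_
    have hmp : MeasurePreserving (fun x : Space d => x - t) volume volume :=
      measurePreserving_sub_right volume t
    have e1 := hf.coeFn_toLp
    have e2 := hmp.quasiMeasurePreserving.ae_eq_comp e1
    filter_upwards [Lp.coeFn_sub (DomAddAct.mk (-t) +ᵥ F) F, e1, e2,
      DomAddAct.vadd_Lp_ae_eq (DomAddAct.mk (-t)) F] with x h1 h2 h3 h4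
    rw [h1, Pi.sub_apply, h2, h4]
    simp only [Function.comp_apply] at h3
    simp only [Equiv.symm_apply_apply, vadd_eq_add, neg_add_eq_sub]
    rw [h3]
    simp [sq]
  have h0 : (DomAddAct.mk (-(0 : Space d)) +ᵥ F) - F = 0 := by
    simp
  have hlim : Filter.Tendsto (fun t : Space d => ‖(DomAddAct.mk (-t) +ᵥ F) - F‖ ^ 2) (𝓝 0)
      (𝓝 0) := by
    have hc : Continuous fun t : Space d => ‖(DomAddAct.mk (-t) +ᵥ F) - F‖ ^ 2 :=
      (hcont.sub continuous_const).norm.pow 2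
    have := hc.tendsto 0
    simpa only [h0, norm_zero, ne_eq, OfNat.ofNat_ne_zero, not_false_eq_true, zero_pow] using this
  have hev := hlim.eventually (gt_mem_nhds hε)
  obtain ⟨δ, hδ, H⟩ := Metric.eventually_nhds_iff.1 hev
  refine ⟨δ, hδ, fun t ht => ?_⟩
  rw [← hsq]
  exact H (by simpa using ht)

/-- Jensen's inequality for the square of a convolution with a normalized bump function. -/
theorem sq_convolution_sub_le {d : ℕ} {f : Space d → ℝ} (hf : MemLp f 2 volume)
    (φ : ContDiffBump (0 : Space d)) (x : Space d) :
    ((φ.normed volume ⋆[ContinuousLinearMap.lsmul ℝ ℝ, volume] f) x - f x) ^ 2 ≤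
      ∫ t, φ.normed volume t * (f (x - t) - f x) ^ 2 := by
  set ρ := φ.normed (volume : Measure (Space d)) with hρ
  have hρi : Integrable ρ := φ.integrable_normed
  have hmp : MeasurePreserving (fun t : Space d => x - t) volume volume :=
    volume.measurePreserving_sub_left x
  have hfx : MemLp (fun t => f (x - t)) 2 volume := hf.comp_measurePreserving hmp
  have hρ2 : MemLp ρ 2 volume :=
    φ.continuous_normed.memLp_of_hasCompactSupport φ.hasCompactSupport_normed
  obtain ⟨B, hB⟩ := (φ.continuous_normed (μ := volume)).bounded_above_of_compact_support
    φ.hasCompactSupport_normed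
  have hi1 : Integrable fun t => ρ t * f (x - t) := hρ2.integrable_mul hfx
  have hi2 : Integrable fun t => ρ t * f (x - t) ^ 2 :=
    hfx.integrable_sq.bdd_mul hρi.aestronglyMeasurable (Filter.Eventually.of_forall hB)
  have h1 : ∫ t, ρ t = 1 := φ.integral_normed
  set m := (ρ ⋆[ContinuousLinearMap.lsmul ℝ ℝ, volume] f) x with hm
  have hm' : m = ∫ t, ρ t * f (x - t) := rfl
  have hexp : ∀ a : ℝ, ∫ t, ρ t * (f (x - t) - a) ^ 2 =
      (∫ t, ρ t * f (x - t) ^ 2) - 2 * a * m + a ^ 2 := by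
    intro a
    have : ∀ t, ρ t * (f (x - t) - a) ^ 2 =
        ρ t * f (x - t) ^ 2 - 2 * a * (ρ t * f (x - t)) + a ^ 2 * ρ t := fun t => by ring
    simp_rw [this]
    have hi3 : Integrable fun t => 2 * a * (ρ t * f (x - t)) := hi1.const_mul _
    have hi4 : Integrable fun t => ρ t * f (x - t) ^ 2 - 2 * a * (ρ t * f (x - t)) := hi2.sub hi3
    rw [integral_add hi4 (hρi.const_mul _), integral_sub hi2 hi3, integral_const_mul,
      integral_const_mul, h1, hm']
    ring
  -- The variance about the weighted mean `m` is nonnegative; the second moment about `f x` exceeds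
  -- it by exactly `(m - f x) ^ 2`.
  have hpos : 0 ≤ ∫ t, ρ t * (f (x - t) - m) ^ 2 :=
    integral_nonneg fun t => mul_nonneg (φ.nonneg_normed t) (sq_nonneg _)
  rw [hexp] at hpos ⊢
  nlinarith

/-- Jensen's inequality and Fubini bound the error by an average of the translation errors over the
support of the mollifier. -/
theorem integral_sq_convolution_sub_le {d : ℕ} {f : Space d → ℝ} (hf : MemLp f 2 volume)
    (φ : ContDiffBump (0 : Space d)) {ε : ℝ}
    (H : ∀ t : Space d, ‖t‖ < φ.rOut → ∫ x, (f (x - t) - f x) ^ 2 ≤ ε) :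
    ∫ x, ((φ.normed volume ⋆[ContinuousLinearMap.lsmul ℝ ℝ, volume] f) x - f x) ^ 2 ≤ ε := by
  set ρ := φ.normed (volume : Measure (Space d)) with hρ
  have hρi : Integrable ρ := φ.integrable_normed
  have hint : Integrable (fun p : Space d × Space d => ρ p.2 * (f (p.1 - p.2) - f p.1) ^ 2)
      (volume.prod volume) := by
    have i1 : Integrable (fun p : Space d × Space d => ρ p.2 * f (p.1 - p.2) ^ 2)
        (volume.prod volume) :=
      Integrable.convolution_integrand (ContinuousLinearMap.mul ℝ ℝ) hρi hf.integrable_sq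
    have i2 : Integrable (fun p : Space d × Space d => ρ p.2 * f p.1 ^ 2)
        (volume.prod volume) := by
      have := hf.integrable_sq.mul_prod hρi
      simpa [mul_comm] using this
    have hms : AEStronglyMeasurable (fun p : Space d × Space d => f (p.1 - p.2))
        (volume.prod volume) :=
      hf.aestronglyMeasurable.comp_quasiMeasurePreserving
        (quasiMeasurePreserving_sub_of_right_invariant volume volume)
    have hmf : AEStronglyMeasurable (fun p : Space d × Space d => f p.1)
        (volume.prod volume) := hf.aestronglyMeasurable.comp_fst
    have hmρ : AEStronglyMeasurable (fun p : Space d × Space d => ρ p.2)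
        (volume.prod volume) := hρi.aestronglyMeasurable.comp_snd
    refine ((i1.const_mul 2).add (i2.const_mul 2)).mono' (hmρ.mul ((hms.sub hmf).pow 2)) ?_
    refine Filter.Eventually.of_forall fun p => ?_
    have h0 : 0 ≤ ρ p.2 := φ.nonneg_normed p.2
    rw [Real.norm_of_nonneg (mul_nonneg h0 (sq_nonneg _))]
    simp only [Pi.add_apply]
    nlinarith [mul_nonneg h0 (sq_nonneg (f (p.1 - p.2) + f p.1))]
  calc _ ≤ ∫ x, ∫ t, ρ t * (f (x - t) - f x) ^ 2 := by
        refine integral_mono_of_nonneg (Filter.Eventually.of_forall fun x => sq_nonneg _)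
          hint.integral_prod_left (Filter.Eventually.of_forall fun x => ?_)
        exact sq_convolution_sub_le hf φ x
    _ = ∫ t, ∫ x, ρ t * (f (x - t) - f x) ^ 2 := integral_integral_swap hint
    _ ≤ ∫ t, ρ t * ε := by
        refine integral_mono_of_nonneg (Filter.Eventually.of_forall fun t =>
          integral_nonneg fun x => mul_nonneg (φ.nonneg_normed t) (sq_nonneg _))
          (hρi.mul_const ε) (Filter.Eventually.of_forall fun t => ?_)
        simp only [integral_const_mul]
        by_cases ht : ‖t‖ < φ.rOut
        · exact mul_le_mul_of_nonneg_left (H t ht) (φ.nonneg_normed t)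
        · have : ρ t = 0 := by
            rw [← Function.notMem_support, hρ, φ.support_normed_eq]
            simpa using ht
          simp [this]
    _ = ε := by rw [integral_mul_const, φ.integral_normed, one_mul]

theorem exists_forall_integral_sq_convolution_sub_le {d : ℕ} {f : Space d → ℝ}
    (hf : MemLp f 2 volume) {ε : ℝ} (hε : 0 < ε) :
    ∃ δ > 0, ∀ φ : ContDiffBump (0 : Space d), φ.rOut < δ →
      ∫ x, ((φ.normed volume ⋆[ContinuousLinearMap.lsmul ℝ ℝ, volume] f) x - f x) ^ 2 ≤ ε := by
  obtain ⟨δ, hδ, H⟩ := exists_forall_integral_translate_sub_sq_lt hf hε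
  exact ⟨δ, hδ, fun φ hφ =>
    integral_sq_convolution_sub_le hf φ fun t ht => (H t (ht.trans hφ)).le⟩

/-! ### Localized `H¹` fields belong to `H¹₀`. -/

theorem continuous_partialDeriv {d : ℕ} {φ : Space d → ℝ} (hφ : ContDiff ℝ (⊤ : ℕ∞) φ)
    (i : Fin d) : Continuous (partialDeriv i φ) :=
  (hφ.continuous_fderiv (by simp)).clm_apply continuous_const

theorem contDiff_partialDeriv {d : ℕ} {φ : Space d → ℝ} (hφ : ContDiff ℝ (⊤ : ℕ∞) φ)
    (i : Fin d) : ContDiff ℝ (⊤ : ℕ∞) (partialDeriv i φ) :=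
  (hφ.fderiv_right (m := (⊤ : ℕ∞)) (by simp)).clm_apply contDiff_const

theorem tsupport_partialDeriv_subset {d : ℕ} (φ : Space d → ℝ) (i : Fin d) :
    tsupport (partialDeriv i φ) ⊆ tsupport φ :=
  tsupport_fderiv_apply_subset ℝ (EuclideanSpace.single i 1)

theorem hasCompactSupport_partialDeriv {d : ℕ} {φ : Space d → ℝ} (hφ : HasCompactSupport φ)
    (i : Fin d) : HasCompactSupport (partialDeriv i φ) :=
  hφ.of_isClosed_subset (isClosed_tsupport _) (tsupport_partialDeriv_subset φ i)

theorem partialDeriv_mul {d : ℕ} {φ ψ : Space d → ℝ} {x : Space d}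
    (hφ : DifferentiableAt ℝ φ x) (hψ : DifferentiableAt ℝ ψ x) (i : Fin d) :
    partialDeriv i (fun y => φ y * ψ y) x =
      φ x * partialDeriv i ψ x + partialDeriv i φ x * ψ x := by
  simp only [partialDeriv]
  rw [fderiv_fun_mul hφ hψ]
  simp [mul_comm]

theorem memLp_mul_of_tsupport_subset {d : ℕ} {Ω : Set (Space d)} (hΩ : MeasurableSet Ω)
    {f η : Space d → ℝ} (hf : MemLp f 2 (volume.restrict Ω)) (hη : Continuous η)
    (hs : HasCompactSupport η) (hsub : tsupport η ⊆ Ω) :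
    MemLp (fun x => η x * f x) 2 volume := by
  have hind : Ω.indicator (fun x => η x * f x) = fun x => η x * f x := by
    refine indicator_eq_self.2 fun x hx => hsub (subset_tsupport η ?_)
    exact left_ne_zero_of_mul hx
  rw [← hind, memLp_indicator_iff_restrict hΩ]
  obtain ⟨B, hB⟩ := hη.bounded_above_of_compact_support hs
  refine hf.of_le_mul (c := B) (hη.aestronglyMeasurable.mul hf.aestronglyMeasurable)
    (Filter.Eventually.of_forall fun x => ?_)
  rw [norm_mul]
  exact mul_le_mul_of_nonneg_right (hB x) (norm_nonneg _)

/-- `g` is the weak derivative of `f` in direction `i` on the whole space. -/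
def IsWeakPartialDeriv {d : ℕ} (i : Fin d) (f g : Space d → ℝ) : Prop :=
  ∀ ψ : Space d → ℝ, ContDiff ℝ (⊤ : ℕ∞) ψ → HasCompactSupport ψ →
    ∫ x, f x * partialDeriv i ψ x = - ∫ x, g x * ψ x

/-- The gradient of `η u`, where `gu` is the gradient of `u`. -/
noncomputable def cutoffGradient {d : ℕ} (η : Space d → ℝ) (u : Space d → Space d)
    (gu : Space d → Mat d) (x : Space d) : Mat d :=
  fun i α => η x * gu x i α + partialDeriv i η x * u x α

section Cutoff

variable {d : ℕ} {Ω : Set (Space d)} {u : Space d → Space d} {gu : Space d → Mat d}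
  {η : Space d → ℝ}

theorem MemH1.memLp_cutoff (hu : MemH1 Ω u gu) (hΩ : IsOpen Ω) (hη : ContDiff ℝ (⊤ : ℕ∞) η)
    (hs : HasCompactSupport η) (hsub : tsupport η ⊆ Ω) (α : Fin d) :
    MemLp (fun x => η x * u x α) 2 volume :=
  memLp_mul_of_tsupport_subset hΩ.measurableSet (hu.memLp.eval_piLp α) hη.continuous hs hsub

theorem MemH1.memLp_partialDeriv_mul (hu : MemH1 Ω u gu) (hΩ : IsOpen Ω)
    (hη : ContDiff ℝ (⊤ : ℕ∞) η) (hs : HasCompactSupport η) (hsub : tsupport η ⊆ Ω)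
    (i α : Fin d) : MemLp (fun x => partialDeriv i η x * u x α) 2 volume :=
  memLp_mul_of_tsupport_subset hΩ.measurableSet (hu.memLp.eval_piLp α)
    (continuous_partialDeriv hη i) (hasCompactSupport_partialDeriv hs i)
    ((tsupport_partialDeriv_subset η i).trans hsub)

theorem MemH1.memLp_cutoffGradient (hu : MemH1 Ω u gu) (hΩ : IsOpen Ω)
    (hη : ContDiff ℝ (⊤ : ℕ∞) η) (hs : HasCompactSupport η) (hsub : tsupport η ⊆ Ω)
    (i α : Fin d) : MemLp (fun x => cutoffGradient η u gu x i α) 2 volume :=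
  (memLp_mul_of_tsupport_subset hΩ.measurableSet (hu.memLp_grad i α) hη.continuous hs hsub).add
    (hu.memLp_partialDeriv_mul hΩ hη hs hsub i α)

/-- For any test function `ψ` on the whole space, `η ψ` is admissible in `Ω`; the product rule does
the rest. -/
theorem MemH1.isWeakPartialDeriv_cutoff (hu : MemH1 Ω u gu) (hΩ : IsOpen Ω)
    (hη : ContDiff ℝ (⊤ : ℕ∞) η) (hs : HasCompactSupport η) (hsub : tsupport η ⊆ Ω)
    (i α : Fin d) :
    IsWeakPartialDeriv i (fun x => η x * u x α) (fun x => cutoffGradient η u gu x i α) := by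
  intro ψ hψ hψs
  have hηψ : ContDiff ℝ (⊤ : ℕ∞) (fun x => η x * ψ x) := hη.mul hψ
  have hψ2 : MemLp ψ 2 volume := hψ.continuous.memLp_of_hasCompactSupport hψs
  have hdψ2 : MemLp (partialDeriv i ψ) 2 volume :=
    (continuous_partialDeriv hψ i).memLp_of_hasCompactSupport (hasCompactSupport_partialDeriv hψs i)
  have hweak := hu.weak (fun x => η x * ψ x) hηψ hs.mul_right
    ((closure_mono (Function.support_mul_subset_left η ψ)).trans hsub) i α
  have hout : ∀ x, x ∉ Ω → η x = 0 := fun x hx => image_eq_zero_of_notMem_tsupport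
    fun h => hx (hsub h)
  have hdout : ∀ x, x ∉ Ω → partialDeriv i η x = 0 := fun x hx =>
    image_eq_zero_of_notMem_tsupport fun h => hx (hsub (tsupport_partialDeriv_subset η i h))
  rw [setIntegral_eq_integral_of_forall_compl_eq_zero,
    setIntegral_eq_integral_of_forall_compl_eq_zero] at hweak
  rotate_left
  · intro x hx
    rw [hout x hx]; ring
  · intro x hx
    rw [partialDeriv_mul (hη.differentiable (by simp) x) (hψ.differentiable (by simp) x),
      hout x hx, hdout x hx]
    ring
  have i1 : Integrable (fun x => η x * u x α * partialDeriv i ψ x) :=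
    (hu.memLp_cutoff hΩ hη hs hsub α).integrable_mul hdψ2
  have i2 : Integrable (fun x => partialDeriv i η x * u x α * ψ x) :=
    (hu.memLp_partialDeriv_mul hΩ hη hs hsub i α).integrable_mul hψ2
  have i3 : Integrable (fun x => η x * gu x i α * ψ x) :=
    (memLp_mul_of_tsupport_subset hΩ.measurableSet (hu.memLp_grad i α) hη.continuous hs
      hsub).integrable_mul hψ2
  have e1 : ∀ x, u x α * partialDeriv i (fun x => η x * ψ x) x =
      η x * u x α * partialDeriv i ψ x + partialDeriv i η x * u x α * ψ x := by
    intro x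
    rw [partialDeriv_mul (hη.differentiable (by simp) x) (hψ.differentiable (by simp) x)]
    ring
  have e2 : ∀ x, gu x i α * (η x * ψ x) = η x * gu x i α * ψ x := fun x => by ring
  have e3 : ∀ x, cutoffGradient η u gu x i α * ψ x =
      η x * gu x i α * ψ x + partialDeriv i η x * u x α * ψ x := fun x => by
    simp only [cutoffGradient]; ring
  simp_rw [e1, e2] at hweak
  simp_rw [e3]
  rw [integral_add i1 i2] at hweak
  rw [integral_add i3 i2]
  linarith

end Cutoff

/-- The derivative falls on the kernel, and `y ↦ ρ (x - y)` is a test function for the weak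
derivative; the sign of the reflection cancels that of the integration by parts. -/
theorem IsWeakPartialDeriv.partialDeriv_convolution {d : ℕ} {i : Fin d} {f g : Space d → ℝ}
    (h : IsWeakPartialDeriv i f g) (hf : LocallyIntegrable f volume)
    {ρ : Space d → ℝ} (hρ : ContDiff ℝ (⊤ : ℕ∞) ρ) (hs : HasCompactSupport ρ) (x : Space d) :
    partialDeriv i (ρ ⋆[ContinuousLinearMap.lsmul ℝ ℝ, volume] f) x =
      (ρ ⋆[ContinuousLinearMap.lsmul ℝ ℝ, volume] g) x := by
  have hρ1 : ContDiff ℝ 1 ρ := hρ.of_le (by simp)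
  have hd := (hs.hasFDerivAt_convolution_left (ContinuousLinearMap.lsmul ℝ ℝ) hρ1 hf x).fderiv
  have hint := (hs.fderiv ℝ).convolutionExists_left
    ((ContinuousLinearMap.lsmul ℝ ℝ).precompL (Space d)) (hρ1.continuous_fderiv one_ne_zero) hf x
  rw [partialDeriv, hd, convolution, ContinuousLinearMap.integral_apply hint]
  simp only [ContinuousLinearMap.precompL_apply, ContinuousLinearMap.lsmul_apply, smul_eq_mul]
  rw [convolution_eq_swap]
  simp only [ContinuousLinearMap.lsmul_apply, smul_eq_mul]
  have hψ : ContDiff ℝ (⊤ : ℕ∞) fun y => ρ (x - y) := hρ.comp (contDiff_const.sub contDiff_id)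
  have hψs : HasCompactSupport fun y => ρ (x - y) :=
    hs.comp_homeomorph (Homeomorph.subLeft x)
  have hw := h _ hψ hψs
  have hdψ : ∀ y, partialDeriv i (fun y => ρ (x - y)) y =
      - fderiv ℝ ρ (x - y) (EuclideanSpace.single i 1) := by
    intro y
    have h1 : HasFDerivAt (fun y => ρ (x - y)) (-(fderiv ℝ ρ (x - y))) y := by
      have := ((hρ.differentiable (by simp) (x - y)).hasFDerivAt).comp y
        ((hasFDerivAt_id y).const_sub x)
      simpa [Function.comp_def] using this
    rw [partialDeriv, h1.fderiv]
    rfl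
  simp_rw [hdψ, mul_neg, integral_neg] at hw
  rw [← integral_sub_left_eq_self (fun t => fderiv ℝ ρ t (EuclideanSpace.single i 1) * f (x - t))
    volume x]
  simp only [sub_sub_cancel]
  simp_rw [mul_comm (g _)] at hw
  rw [← neg_inj.1 hw]
  simp_rw [mul_comm (f _)]

/-- A field with weak gradient on the whole space that vanishes outside a compact subset of `Ω`
belongs to `H¹₀(Ω)`. -/
theorem memH10_of_isWeakPartialDeriv {d : ℕ} {Ω K : Set (Space d)} (hΩ : IsOpen Ω)
    (hK : IsCompact K) (hKΩ : K ⊆ Ω) {v : Space d → Space d} {gv : Space d → Mat d}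
    (hv : ∀ α, MemLp (fun x => v x α) 2 volume)
    (hgv : ∀ i α, MemLp (fun x => gv x i α) 2 volume)
    (hv0 : ∀ x, x ∉ K → v x = 0) (hgv0 : ∀ x, x ∉ K → gv x = 0)
    (hweak : ∀ i α, IsWeakPartialDeriv i (fun x => v x α) (fun x => gv x i α)) :
    MemH10 Ω v gv := by
  refine ⟨⟨(MemLp.of_eval_piLp hv).restrict Ω, fun i α => (hgv i α).restrict Ω, ?_⟩, ?_⟩
  · intro φ hφ hφs _ i α
    have := hweak i α φ hφ hφs
    rwa [setIntegral_eq_integral_of_forall_compl_eq_zero,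
      setIntegral_eq_integral_of_forall_compl_eq_zero]
    · intro x hx
      simp [hgv0 x fun h => hx (hKΩ h)]
    · intro x hx
      simp [hv0 x fun h => hx (hKΩ h)]
  · intro ε hε
    -- There are `d` components and `d * d` gradient entries, each allowed an error `ε / N`; the
    -- extra `1` makes the final inequality strict.
    set N : ℝ := (d : ℝ) + d * d + 1 with hN
    have hNpos : 0 < N := by positivity
    have hεN : 0 < ε / N := by positivity
    obtain ⟨δ₀, hδ₀, hthick⟩ := hK.exists_cthickening_subset_open hΩ hKΩ
    choose δ₁ hδ₁ H₁ using fun α => exists_forall_integral_sq_convolution_sub_le (hv α) hεN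
    choose δ₂ hδ₂ H₂ using fun i α => exists_forall_integral_sq_convolution_sub_le (hgv i α) hεN
    obtain ⟨δ, hδ, hle₀, hle₁, hle₂⟩ : ∃ δ : ℝ, 0 < δ ∧ δ < δ₀ ∧ (∀ α, δ < δ₁ α) ∧
        ∀ i α, δ < δ₂ i α := by
      have h0 : ∀ᶠ δ : ℝ in 𝓝[>] 0, 0 < δ := self_mem_nhdsWithin
      have hlt : ∀ a : ℝ, 0 < a → ∀ᶠ δ : ℝ in 𝓝[>] 0, δ < a := fun a ha =>
        nhdsWithin_le_nhds (gt_mem_nhds ha)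
      exact (h0.and ((hlt _ hδ₀).and ((Filter.eventually_all.2 fun α => hlt _ (hδ₁ α)).and
        (Filter.eventually_all.2 fun i => Filter.eventually_all.2 fun α =>
          hlt _ (hδ₂ i α))))).exists
    let ρ : ContDiffBump (0 : Space d) := ⟨δ / 2, δ, by positivity, by linarith⟩
    have hρ : ContDiff ℝ (⊤ : ℕ∞) (ρ.normed volume) := ρ.contDiff_normed
    have hρs : HasCompactSupport (ρ.normed volume) := ρ.hasCompactSupport_normed
    let w : Fin d → Space d → ℝ := fun α =>
      ρ.normed volume ⋆[ContinuousLinearMap.lsmul ℝ ℝ, volume] fun x => v x α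
    let gw : Fin d → Fin d → Space d → ℝ := fun i α =>
      ρ.normed volume ⋆[ContinuousLinearMap.lsmul ℝ ℝ, volume] fun x => gv x i α
    have hli : ∀ α, LocallyIntegrable (fun x => v x α) volume := fun α =>
      (hv α).locallyIntegrable (by norm_num)
    have hw : ∀ α, ContDiff ℝ (⊤ : ℕ∞) (w α) := fun α =>
      hρs.contDiff_convolution_left _ hρ (hli α)
    have hgw : ∀ i α x, partialDeriv i (w α) x = gw i α x := fun i α x =>
      (hweak i α).partialDeriv_convolution (hli α) hρ hρs x
    let φ : Space d → Space d := fun x => WithLp.toLp 2 fun α => w α x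
    have hsupp : Function.support φ ⊆ cthickening δ K := by
      intro x hx
      by_contra hx'
      refine hx (PiLp.ext fun α => ?_)
      change w α x = 0
      have hzero : ∀ y ∈ ball x ρ.rOut, v y = 0 := by
        intro y hy
        refine hv0 y fun hyK => hx' ?_
        exact mem_cthickening_of_dist_le x y δ K hyK (mem_ball'.1 hy).le
      have hc : ∀ y ∈ ball x ρ.rOut, v y α = v x α := fun y hy => by
        rw [hzero y hy, hzero x (mem_ball_self ρ.rOut_pos)]
      simp only [w]
      rw [ρ.normed_convolution_eq_right hc, hzero x (mem_ball_self ρ.rOut_pos)]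
      rfl
    have htsupp : tsupport φ ⊆ cthickening δ K := closure_minimal hsupp isClosed_cthickening
    refine ⟨φ, contDiff_euclidean.2 hw,
      hK.cthickening.of_isClosed_subset (isClosed_tsupport φ) htsupp,
      htsupp.trans ((cthickening_mono hle₀.le K).trans hthick), ?_⟩
    have hφ2 : ∀ α, MemLp (w α) 2 volume := fun α => by
      refine (hw α).continuous.memLp_of_hasCompactSupport
        (HasCompactSupport.of_support_subset_isCompact (hK.cthickening (r := δ)) ?_)
      intro x hx
      refine hsupp fun h0 => hx ?_
      exact congrFun (congrArg WithLp.ofLp h0) α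
    have hws : ∀ α, HasCompactSupport (w α) := fun α => by
      refine HasCompactSupport.of_support_subset_isCompact (hK.cthickening (r := δ)) ?_
      intro x hx
      refine hsupp fun h0 => hx ?_
      exact congrFun (congrArg WithLp.ofLp h0) α
    have hgw2 : ∀ i α, MemLp (gw i α) 2 volume := fun i α => by
      rw [show gw i α = partialDeriv i (w α) from funext fun x => (hgw i α x).symm]
      exact (continuous_partialDeriv (hw α) i).memLp_of_hasCompactSupport
        (hasCompactSupport_partialDeriv (hws α) i)
    have hI₁ : ∀ α, Integrable (fun x => (w α x - v x α) ^ 2) volume := fun α =>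
      ((hφ2 α).sub (hv α)).integrable_sq
    have hI₂ : ∀ i α, Integrable (fun x => (gw i α x - gv x i α) ^ 2) volume := fun i α =>
      ((hgw2 i α).sub (hgv i α)).integrable_sq
    have b₁ : ∫ x in Ω, ‖v x - φ x‖ ^ 2 ≤ d * (ε / N) := by
      have e : ∀ x, ‖v x - φ x‖ ^ 2 = ∑ α, (w α x - v x α) ^ 2 := fun x => by
        rw [EuclideanSpace.real_norm_sq_eq]
        refine Finset.sum_congr rfl fun α _ => ?_
        simp only [PiLp.sub_apply, φ]
        ring
      simp_rw [e]
      rw [integral_finsetSum _ fun α _ => (hI₁ α).integrableOn]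
      calc _ ≤ ∑ α : Fin d, ε / N := Finset.sum_le_sum fun α _ =>
            (setIntegral_le_integral (hI₁ α)
              (Filter.Eventually.of_forall fun x => sq_nonneg _)).trans (H₁ α ρ (hle₁ α))
        _ = _ := by simp
    have b₂ : ∫ x in Ω, normSq (gv x - gradient φ x) ≤ d * (d * (ε / N)) := by
      have e : ∀ x, normSq (gv x - gradient φ x) = ∑ i, ∑ α, (gw i α x - gv x i α) ^ 2 :=
        fun x => by
          refine Finset.sum_congr rfl fun i _ => Finset.sum_congr rfl fun α _ => ?_
          rw [← hgw]
          simp only [Pi.sub_apply, gradient, φ]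
          ring
      simp_rw [e]
      rw [integral_finsetSum _ fun i _ => integrable_finsetSum _ fun α _ =>
        (hI₂ i α).integrableOn]
      calc _ ≤ ∑ i : Fin d, ∑ α : Fin d, ε / N := Finset.sum_le_sum fun i _ => by
            rw [integral_finsetSum _ fun α _ => (hI₂ i α).integrableOn]
            exact Finset.sum_le_sum fun α _ => (setIntegral_le_integral (hI₂ i α)
              (Filter.Eventually.of_forall fun x => sq_nonneg _)).trans (H₂ i α ρ (hle₂ i α))
        _ = _ := by simp
    have hfin : (d : ℝ) * (ε / N) + d * (d * (ε / N)) < ε := by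
      have : N * (ε / N) = ε := mul_div_cancel₀ ε hNpos.ne'
      nlinarith
    linarith

theorem MemH1.memH10_cutoff {d : ℕ} {Ω : Set (Space d)} {u : Space d → Space d}
    {gu : Space d → Mat d} {η : Space d → ℝ} (hu : MemH1 Ω u gu) (hΩ : IsOpen Ω)
    (hη : ContDiff ℝ (⊤ : ℕ∞) η) (hs : HasCompactSupport η) (hsub : tsupport η ⊆ Ω) :
    MemH10 Ω (fun x => η x • u x) (cutoffGradient η u gu) := by
  refine memH10_of_isWeakPartialDeriv hΩ hs hsub (fun α => hu.memLp_cutoff hΩ hη hs hsub α)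
    (fun i α => hu.memLp_cutoffGradient hΩ hη hs hsub i α) ?_ ?_
    (fun i α => hu.isWeakPartialDeriv_cutoff hΩ hη hs hsub i α)
  · intro x hx
    rw [image_eq_zero_of_notMem_tsupport hx, zero_smul]
  · intro x hx
    ext i α
    have h1 : η x = 0 := image_eq_zero_of_notMem_tsupport hx
    have h2 : partialDeriv i η x = 0 :=
      image_eq_zero_of_notMem_tsupport fun h => hx (tsupport_partialDeriv_subset η i h)
    simp [cutoffGradient, h1, h2]

/-! ### Korn's first inequality -/

theorem normSq_nonneg {d : ℕ} (ξ : Mat d) : 0 ≤ normSq ξ :=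
  Finset.sum_nonneg fun _ _ => Finset.sum_nonneg fun _ _ => sq_nonneg _

/-- `ξ : ξᵀ`, the scalar product of a matrix with its transpose. -/
def transposeProd {d : ℕ} (ξ : Mat d) : ℝ := ∑ i, ∑ α, ξ i α * ξ α i

theorem normSq_eq_sum_half {d : ℕ} (ξ : Mat d) :
    normSq ξ = ∑ i, ∑ α, (ξ i α ^ 2 / 2 + ξ α i ^ 2 / 2) := by
  have hswap : ∑ i, ∑ α, ξ α i ^ 2 = ∑ i, ∑ α, ξ i α ^ 2 := Finset.sum_comm
  simp_rw [Finset.sum_add_distrib, ← Finset.sum_div]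
  rw [hswap, normSq]
  ring

theorem two_mul_normSq_symPart {d : ℕ} (ξ : Mat d) :
    2 * normSq (symPart ξ) = normSq ξ + transposeProd ξ := by
  rw [normSq_eq_sum_half ξ, transposeProd, normSq, Finset.mul_sum, ← Finset.sum_add_distrib]
  refine Finset.sum_congr rfl fun i _ => ?_
  rw [Finset.mul_sum, ← Finset.sum_add_distrib]
  refine Finset.sum_congr rfl fun α _ => ?_
  simp only [symPart]
  ring

theorem normSq_symPart_le {d : ℕ} (ξ : Mat d) : normSq (symPart ξ) ≤ normSq ξ := by
  have h : transposeProd ξ ≤ normSq ξ := by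
    rw [normSq_eq_sum_half]
    refine Finset.sum_le_sum fun i _ => Finset.sum_le_sum fun α _ => ?_
    nlinarith [sq_nonneg (ξ i α - ξ α i)]
  linarith [two_mul_normSq_symPart ξ]

/-- Young's inequality with weight `s` on the cross terms; it lets the sign of `∫ ξ : ξᵀ` pass to
limits in `L²`. -/
theorem transposeProd_sub_le {d : ℕ} (ξ ζ : Mat d) {s : ℝ} (hs : 0 < s) :
    transposeProd (ξ - ζ) ≤ transposeProd ξ + s * normSq ξ + (1 + s⁻¹) * normSq ζ := by
  have hyoung : ∀ a b : ℝ, -(a * b) ≤ s * a ^ 2 / 2 + s⁻¹ * b ^ 2 / 2 := by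
    intro a b
    have h1 : s⁻¹ * (s * a + b) ^ 2 = s * a ^ 2 + 2 * (a * b) + s⁻¹ * b ^ 2 := by
      field_simp
      ring
    have h2 : 0 ≤ s⁻¹ * (s * a + b) ^ 2 := by positivity
    linarith
  rw [normSq_eq_sum_half ξ, normSq_eq_sum_half ζ]
  simp only [transposeProd, Finset.mul_sum]
  simp only [← Finset.sum_add_distrib]
  refine Finset.sum_le_sum fun i _ => Finset.sum_le_sum fun α _ => ?_
  simp only [Pi.sub_apply]
  have h1 := hyoung (ξ i α) (ζ α i)
  have h2 := hyoung (ξ α i) (ζ i α)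
  nlinarith [sq_nonneg (ζ i α - ζ α i)]

theorem partialDeriv_comm {d : ℕ} {φ : Space d → ℝ} (hφ : ContDiff ℝ (⊤ : ℕ∞) φ)
    (i j : Fin d) (x : Space d) :
    partialDeriv i (partialDeriv j φ) x = partialDeriv j (partialDeriv i φ) x := by
  have hd : DifferentiableAt ℝ (fderiv ℝ φ) x :=
    (hφ.fderiv_right (m := (⊤ : ℕ∞)) (by simp)).differentiable (by simp) x
  have h : ∀ k l : Fin d, partialDeriv k (partialDeriv l φ) x =
      fderiv ℝ (fderiv ℝ φ) x (EuclideanSpace.single k 1) (EuclideanSpace.single l 1) := by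
    intro k l
    have : HasFDerivAt (partialDeriv l φ) _ x :=
      hd.hasFDerivAt.clm_apply (hasFDerivAt_const (EuclideanSpace.single l (1 : ℝ)) x)
    rw [partialDeriv, this.fderiv]
    simp
  rw [h, h]
  exact (hφ.contDiffAt.isSymmSndFDerivAt (by
    rw [minSmoothness_of_isRCLikeNormedField]
    exact WithTop.coe_le_coe.2 (le_top : (2 : ℕ∞) ≤ ⊤))) _ _

theorem integral_mul_partialDeriv {d : ℕ} {φ ψ : Space d → ℝ} (hφ : ContDiff ℝ (⊤ : ℕ∞) φ)
    (hψ : ContDiff ℝ (⊤ : ℕ∞) ψ) (hφs : HasCompactSupport φ) (i : Fin d) :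
    ∫ x, φ x * partialDeriv i ψ x = - ∫ x, partialDeriv i φ x * ψ x := by
  refine integral_mul_fderiv_eq_neg_fderiv_mul_of_integrable ?_ ?_ ?_
    (fun x _ => hφ.differentiable (by simp) x) (fun x _ => hψ.differentiable (by simp) x)
  · exact ((continuous_partialDeriv hφ i).mul hψ.continuous).integrable_of_hasCompactSupport
      (hasCompactSupport_partialDeriv hφs i).mul_right
  · exact (hφ.continuous.mul (continuous_partialDeriv hψ i)).integrable_of_hasCompactSupport
      hφs.mul_right
  · exact (hφ.continuous.mul hψ.continuous).integrable_of_hasCompactSupport hφs.mul_right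

/-- Two integrations by parts exchange the derivatives in `∂ᵢφ^α ∂_αφ^i`, so the integral equals `∫
(div φ)²`. -/
theorem integral_transposeProd_gradient_nonneg {d : ℕ} {φ : Space d → Space d}
    (hφ : ContDiff ℝ (⊤ : ℕ∞) φ) (hs : HasCompactSupport φ) :
    0 ≤ ∫ x, transposeProd (gradient φ x) := by
  let c : Fin d → Space d → ℝ := fun α x => φ x α
  have hc : ∀ α, ContDiff ℝ (⊤ : ℕ∞) (c α) := contDiff_euclidean.1 hφ
  have hcs : ∀ α, HasCompactSupport (c α) := fun α =>
    hs.comp_left (g := fun y : Space d => y α) rfl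
  have hint : ∀ i α j β, Integrable (fun x => partialDeriv i (c α) x * partialDeriv j (c β) x)
      volume := fun i α j β =>
    ((continuous_partialDeriv (hc α) i).mul
      (continuous_partialDeriv (hc β) j)).integrable_of_hasCompactSupport
      (hasCompactSupport_partialDeriv (hcs α) i).mul_right
  have hparts : ∀ i α, ∫ x, partialDeriv i (c α) x * partialDeriv α (c i) x =
      ∫ x, partialDeriv α (c α) x * partialDeriv i (c i) x := by
    intro i α
    rw [integral_mul_partialDeriv (contDiff_partialDeriv (hc α) i) (hc i)
        (hasCompactSupport_partialDeriv (hcs α) i),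
      integral_mul_partialDeriv (contDiff_partialDeriv (hc α) α) (hc i)
        (hasCompactSupport_partialDeriv (hcs α) α)]
    simp_rw [partialDeriv_comm (hc α)]
  have h1 : ∫ x, transposeProd (gradient φ x) =
      ∑ i, ∑ α, ∫ x, partialDeriv i (c α) x * partialDeriv α (c i) x := by
    change ∫ x, ∑ i, ∑ α, partialDeriv i (c α) x * partialDeriv α (c i) x = _
    rw [integral_finsetSum _ fun i _ => integrable_finsetSum _ fun α _ => hint i α α i]
    exact Finset.sum_congr rfl fun i _ => integral_finsetSum _ fun α _ => hint i α α i
  have h2 : ∫ x, (∑ i, partialDeriv i (c i) x) ^ 2 =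
      ∑ i, ∑ α, ∫ x, partialDeriv α (c α) x * partialDeriv i (c i) x := by
    have e : ∀ x, (∑ i, partialDeriv i (c i) x) ^ 2 =
        ∑ i, ∑ α, partialDeriv α (c α) x * partialDeriv i (c i) x := fun x => by
      rw [sq, Finset.sum_mul_sum, Finset.sum_comm]
    simp_rw [e]
    rw [integral_finsetSum _ fun i _ => integrable_finsetSum _ fun α _ => hint α α i i]
    exact Finset.sum_congr rfl fun i _ => integral_finsetSum _ fun α _ => hint α α i i
  rw [h1, Finset.sum_congr rfl fun i _ => Finset.sum_congr rfl fun α _ => hparts i α, ← h2]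
  exact integral_nonneg fun x => sq_nonneg _

theorem integrable_normSq {d : ℕ} {μ : Measure (Space d)} {g : Space d → Mat d}
    (hg : ∀ i α, MemLp (fun x => g x i α) 2 μ) : Integrable (fun x => normSq (g x)) μ :=
  integrable_finsetSum _ fun i _ => integrable_finsetSum _ fun α _ => (hg i α).integrable_sq

theorem memLp_symPart {d : ℕ} {μ : Measure (Space d)} {g : Space d → Mat d}
    (hg : ∀ i α, MemLp (fun x => g x i α) 2 μ) (i α : Fin d) :
    MemLp (fun x => symPart (g x) i α) 2 μ := by
  simp only [symPart, div_eq_mul_inv]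
  exact ((hg i α).add (hg α i)).mul_const _

theorem integrable_transposeProd {d : ℕ} {μ : Measure (Space d)} {g : Space d → Mat d}
    (hg : ∀ i α, MemLp (fun x => g x i α) 2 μ) : Integrable (fun x => transposeProd (g x)) μ :=
  integrable_finsetSum _ fun i _ => integrable_finsetSum _ fun α _ =>
    (hg i α).integrable_mul (hg α i)

theorem memLp_gradient {d : ℕ} {φ : Space d → Space d} (hφ : ContDiff ℝ (⊤ : ℕ∞) φ)
    (hs : HasCompactSupport φ) (i α : Fin d) : MemLp (fun x => gradient φ x i α) 2 volume :=
  (continuous_partialDeriv (contDiff_euclidean.1 hφ α) i).memLp_of_hasCompactSupport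
    (hasCompactSupport_partialDeriv (hs.comp_left (g := fun y : Space d => y α) rfl) i)

theorem gradient_eq_zero_of_notMem_tsupport {d : ℕ} {φ : Space d → Space d} {x : Space d}
    (hx : x ∉ tsupport φ) : gradient φ x = 0 := by
  ext i α
  refine image_eq_zero_of_notMem_tsupport (f := partialDeriv i fun y => φ y α) fun h => hx ?_
  refine closure_mono ?_ (tsupport_partialDeriv_subset _ i h)
  intro y hy h0
  exact hy (by simp [h0])

theorem MemH10.integral_transposeProd_nonneg {d : ℕ} {Ω : Set (Space d)} {v : Space d → Space d}
    {gv : Space d → Mat d} (hv : MemH10 Ω v gv) :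
    0 ≤ ∫ x in Ω, transposeProd (gv x) := by
  set N := ∫ x in Ω, normSq (gv x) with hN
  have hN0 : 0 ≤ N := integral_nonneg fun x => normSq_nonneg _
  have hstep : ∀ s : ℝ, 0 < s → ∀ ε : ℝ, 0 < ε →
      0 ≤ (∫ x in Ω, transposeProd (gv x)) + s * N + (1 + s⁻¹) * ε := by
    intro s hs ε hε
    obtain ⟨φ, hφ, hφs, hφΩ, happ⟩ := hv.approx ε hε
    have hφ2 : ∀ i α, MemLp (fun x => gradient φ x i α) 2 (volume.restrict Ω) := fun i α =>
      (memLp_gradient hφ hφs i α).restrict Ω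
    have hd2 : ∀ i α, MemLp (fun x => (gv x - gradient φ x) i α) 2 (volume.restrict Ω) :=
      fun i α => (hv.memH1.memLp_grad i α).sub (hφ2 i α)
    have h0 : 0 ≤ ∫ x in Ω, transposeProd (gradient φ x) := by
      rw [setIntegral_eq_integral_of_forall_compl_eq_zero]
      · exact integral_transposeProd_gradient_nonneg hφ hφs
      · intro x hx
        rw [gradient_eq_zero_of_notMem_tsupport fun h => hx (hφΩ h)]
        simp [transposeProd]
    have hE : ∫ x in Ω, normSq (gv x - gradient φ x) ≤ ε := by
      have : 0 ≤ ∫ x in Ω, ‖v x - φ x‖ ^ 2 := integral_nonneg fun x => by positivity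
      linarith
    have i1 := integrable_transposeProd hv.memH1.memLp_grad
    have i2 := (integrable_normSq hv.memH1.memLp_grad).const_mul s
    have i3 := (integrable_normSq hd2).const_mul (1 + s⁻¹)
    have hle : ∫ x in Ω, transposeProd (gradient φ x) ≤
        ∫ x in Ω, (transposeProd (gv x) + s * normSq (gv x) +
          (1 + s⁻¹) * normSq (gv x - gradient φ x)) := by
      refine integral_mono (integrable_transposeProd hφ2) ((i1.add i2).add i3) fun x => ?_
      have := transposeProd_sub_le (gv x) (gv x - gradient φ x) hs
      rwa [sub_sub_cancel] at this
    have i12 : Integrable (fun x => transposeProd (gv x) + s * normSq (gv x))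
      (volume.restrict Ω) := i1.add i2
    rw [integral_add i12 i3, integral_add i1 i2, integral_const_mul, integral_const_mul] at hle
    have : (1 + s⁻¹) * ∫ x in Ω, normSq (gv x - gradient φ x) ≤ (1 + s⁻¹) * ε :=
      mul_le_mul_of_nonneg_left hE (by positivity)
    linarith
  refine le_of_forall_pos_le_add fun κ hκ => ?_
  -- First `s` makes `s * N ≤ κ / 2`, then the approximation error is chosen so that its term is `κ
  -- / 2`; `N + 1` avoids division by zero.
  have hs : 0 < κ / (2 * (N + 1)) := by positivity
  have hq : 0 < 1 + (κ / (2 * (N + 1)))⁻¹ := by positivity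
  have := hstep _ hs (κ / 2 / (1 + (κ / (2 * (N + 1)))⁻¹)) (by positivity)
  rw [mul_div_cancel₀ _ hq.ne'] at this
  have hsN : κ / (2 * (N + 1)) * N ≤ κ / 2 := by
    rw [div_mul_eq_mul_div, div_le_div_iff₀ (by positivity) (by positivity)]
    nlinarith
  linarith

/-- Korn's first inequality in `H¹₀`. -/
theorem MemH10.integral_normSq_le {d : ℕ} {Ω : Set (Space d)} {v : Space d → Space d}
    {gv : Space d → Mat d} (hv : MemH10 Ω v gv) :
    ∫ x in Ω, normSq (gv x) ≤ 2 * ∫ x in Ω, normSq (symPart (gv x)) := by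
  have h := hv.integral_transposeProd_nonneg
  rw [← integral_const_mul]
  simp_rw [two_mul_normSq_symPart]
  rw [integral_add (integrable_normSq hv.memH1.memLp_grad)
    (integrable_transposeProd hv.memH1.memLp_grad)]
  linarith

/-! ### The elasticity tensor -/

section Contract

variable {d : ℕ} {κ₁ κ₂ : ℝ} {a : Tensor d}

theorem contract_add_left (a : Tensor d) (ξ ξ' ζ : Mat d) :
    contract a (ξ + ξ') ζ = contract a ξ ζ + contract a ξ' ζ := by
  simp only [contract, Pi.add_apply, mul_add, add_mul, Finset.sum_add_distrib]

theorem contract_add_right (a : Tensor d) (ξ ζ ζ' : Mat d) :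
    contract a ξ (ζ + ζ') = contract a ξ ζ + contract a ξ ζ' := by
  simp only [contract, Pi.add_apply, mul_add, Finset.sum_add_distrib]

theorem contract_smul_left (a : Tensor d) (s : ℝ) (ξ ζ : Mat d) :
    contract a (s • ξ) ζ = s * contract a ξ ζ := by
  simp only [contract, Pi.smul_apply, smul_eq_mul, Finset.mul_sum]
  exact Finset.sum_congr rfl fun i _ => Finset.sum_congr rfl fun j _ =>
    Finset.sum_congr rfl fun α _ => Finset.sum_congr rfl fun β _ => by ring

theorem contract_smul_right (a : Tensor d) (s : ℝ) (ξ ζ : Mat d) :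
    contract a ξ (s • ζ) = s * contract a ξ ζ := by
  simp only [contract, Pi.smul_apply, smul_eq_mul, Finset.mul_sum]
  exact Finset.sum_congr rfl fun i _ => Finset.sum_congr rfl fun j _ =>
    Finset.sum_congr rfl fun α _ => Finset.sum_congr rfl fun β _ => by ring

theorem IsElastic.contract_comm (h : IsElastic κ₁ κ₂ a) (ξ ζ : Mat d) :
    contract a ξ ζ = contract a ζ ξ := by
  simp only [contract]
  rw [Finset.sum_comm]
  refine Finset.sum_congr rfl fun i _ => Finset.sum_congr rfl fun j _ => ?_
  rw [Finset.sum_comm]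
  refine Finset.sum_congr rfl fun α _ => Finset.sum_congr rfl fun β _ => ?_
  rw [h.symm₁ j i β α]
  ring

theorem IsElastic.contract_transpose_right (h : IsElastic κ₁ κ₂ a) (ξ ζ : Mat d) :
    contract a ξ (fun i α => ζ α i) = contract a ξ ζ := by
  have e : ∀ ζ : Mat d, contract a ξ ζ =
      ∑ i, ∑ α, ∑ j, ∑ β, a i j α β * ξ j β * ζ i α := fun ζ =>
    Finset.sum_congr rfl fun i _ => Finset.sum_comm
  rw [e, e, Finset.sum_comm]
  refine Finset.sum_congr rfl fun i _ => Finset.sum_congr rfl fun α _ =>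
    Finset.sum_congr rfl fun j _ => Finset.sum_congr rfl fun β _ => ?_
  rw [h.symm₂ α j i β]

theorem IsElastic.contract_symPart_right (h : IsElastic κ₁ κ₂ a) (ξ ζ : Mat d) :
    contract a ξ (symPart ζ) = contract a ξ ζ := by
  have : symPart ζ = (1 / 2 : ℝ) • (ζ + fun i α => ζ α i) := by
    ext i α
    simp only [symPart, Pi.smul_apply, Pi.add_apply, smul_eq_mul]
    ring
  rw [this, contract_smul_right, contract_add_right, h.contract_transpose_right]
  ring

theorem IsElastic.contract_symPart_self (h : IsElastic κ₁ κ₂ a) (ξ : Mat d) :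
    contract a (symPart ξ) (symPart ξ) = contract a ξ ξ := by
  rw [h.contract_symPart_right, h.contract_comm, h.contract_symPart_right]

theorem contract_self_eq (a : Tensor d) (ξ : Mat d) :
    contract a ξ ξ = ∑ i, ∑ j, ∑ α, ∑ β, a i j α β * ξ i α * ξ j β :=
  Finset.sum_congr rfl fun i _ => Finset.sum_congr rfl fun j _ =>
    Finset.sum_congr rfl fun α _ => Finset.sum_congr rfl fun β _ => by ring

theorem symPart_symm (ξ : Mat d) (i α : Fin d) : symPart ξ i α = symPart ξ α i := by
  simp only [symPart, add_comm]

theorem IsElastic.le_contract_self (h : IsElastic κ₁ κ₂ a) (ξ : Mat d) :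
    κ₁ * normSq (symPart ξ) ≤ contract a ξ ξ := by
  rw [← h.contract_symPart_self, contract_self_eq]
  exact h.lower _ (symPart_symm ξ)

theorem IsElastic.contract_self_le (h : IsElastic κ₁ κ₂ a) (hκ₂ : 0 ≤ κ₂) (ξ : Mat d) :
    contract a ξ ξ ≤ κ₂ * normSq ξ := by
  rw [← h.contract_symPart_self, contract_self_eq]
  exact (h.upper _ (symPart_symm ξ)).trans
    (mul_le_mul_of_nonneg_left (normSq_symPart_le ξ) hκ₂)

/-- Completing the square: with `s = η`, `ξ = ∇u` and `τ = ∇η ⊗ u`, the second argument on the left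
is `∇(η² u)` and `s ξ + τ` is `∇(η u)`. No cross term has to be absorbed afterwards. -/
theorem IsElastic.contract_cutoff (h : IsElastic κ₁ κ₂ a) (s : ℝ) (ξ τ : Mat d) :
    contract a ξ (s ^ 2 • ξ + (2 * s) • τ) =
      contract a (s • ξ + τ) (s • ξ + τ) - contract a τ τ := by
  simp only [contract_add_left, contract_add_right, contract_smul_left, contract_smul_right]
  rw [h.contract_comm τ ξ]
  ring

/-- No bound on the entries of `A` is needed: the quadratic form lies between `0` and `κ₂ |g|²`. -/
theorem IsCoefficient.integrable_contract_self {A : Space d → Tensor d}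
    (hA : IsCoefficient κ₁ κ₂ A) (hκ₁ : 0 ≤ κ₁) (hκ₂ : 0 ≤ κ₂) {S : Set (Space d)}
    {g : Space d → Mat d} (hg : ∀ i α, MemLp (fun x => g x i α) 2 (volume.restrict S)) :
    Integrable (fun x => contract (A x) (g x) (g x)) (volume.restrict S) := by
  refine ((integrable_normSq hg).const_mul κ₂).mono' ?_ ?_
  · refine Finset.aestronglyMeasurable_fun_sum _ fun i _ =>
      Finset.aestronglyMeasurable_fun_sum _ fun j _ =>
      Finset.aestronglyMeasurable_fun_sum _ fun α _ =>
      Finset.aestronglyMeasurable_fun_sum _ fun β _ => ?_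
    exact ((hA.measurable i j α β).restrict.aestronglyMeasurable.mul
      (hg j β).aestronglyMeasurable).mul (hg i α).aestronglyMeasurable
  · filter_upwards [ae_restrict_of_ae hA.elastic] with x hx
    rw [Real.norm_of_nonneg]
    · exact hx.contract_self_le hκ₂ _
    · exact (mul_nonneg hκ₁ (normSq_nonneg _)).trans (hx.le_contract_self _)

end Contract

/-! ### The Caccioppoli inequality. -/

theorem cutoffGradient_sq {d : ℕ} {η : Space d → ℝ} (hη : ContDiff ℝ (⊤ : ℕ∞) η)
    (u : Space d → Space d) (gu : Space d → Mat d) (x : Space d) :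
    cutoffGradient (fun y => η y * η y) u gu x =
      η x ^ 2 • gu x + (2 * η x) • fun i α => partialDeriv i η x * u x α := by
  ext i α
  have hd : DifferentiableAt ℝ η x := hη.differentiable (by simp) x
  simp only [cutoffGradient, partialDeriv_mul hd hd, Pi.add_apply, Pi.smul_apply, smul_eq_mul]
  ring

theorem symPart_cutoffGradient_eq_zero {d : ℕ} {η : Space d → ℝ} {u : Space d → Space d}
    {gu : Space d → Mat d} {x : Space d} (hη : fderiv ℝ η x = 0) (hgu : symPart (gu x) = 0) :
    symPart (cutoffGradient η u gu x) = 0 := by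
  ext i α
  have h : (gu x i α + gu x α i) / 2 = 0 := congrFun (congrFun hgu i) α
  simp only [symPart, cutoffGradient, partialDeriv, hη, zero_apply,
    Pi.zero_apply]
  linear_combination η x * h

theorem normSq_partialDeriv_mul_le {d : ℕ} {η : Space d → ℝ} {x : Space d} {b : ℝ}
    (hb : ‖fderiv ℝ η x‖ ≤ b) (v : Space d) :
    normSq (fun i α => partialDeriv i η x * v α) ≤ d * b ^ 2 * ‖v‖ ^ 2 := by
  have hi : ∀ i, partialDeriv i η x ^ 2 ≤ b ^ 2 := fun i => by
    rw [← sq_abs]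
    refine pow_le_pow_left₀ (abs_nonneg _) ?_ 2
    refine ((fderiv ℝ η x).le_opNorm _).trans ?_
    rw [PiLp.norm_single, norm_one, mul_one]
    exact hb
  rw [EuclideanSpace.real_norm_sq_eq]
  simp only [normSq, mul_pow, ← Finset.mul_sum]
  rw [← Finset.sum_mul]
  refine mul_le_mul_of_nonneg_right ?_ (Finset.sum_nonneg fun α _ => sq_nonneg _)
  exact (Finset.sum_le_sum fun i _ => hi i).trans (by simp)

/-- Caccioppoli's inequality for a cutoff function that is locally constant on the inclusions. -/
theorem IsStiffSolution.integral_normSq_cutoffGradient_le {d : ℕ} {ω Ω : Set (Space d)}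
    (hnull : volume (ωᶜ \ inclusions ω) = 0) (hΩ : IsOpen Ω)
    {κ₁ κ₂ : ℝ} (hκ₁ : 0 < κ₁) (hκ₂ : 0 ≤ κ₂) {A : Space d → Tensor d}
    (hA : IsCoefficient κ₁ κ₂ A) {u : Space d → Space d} {gu : Space d → Mat d}
    (hu : IsStiffSolution ω A Ω u gu) {η : Space d → ℝ} (hη : ContDiff ℝ (⊤ : ℕ∞) η)
    (hs : HasCompactSupport η) (hsub : tsupport η ⊆ Ω) {b : ℝ}
    (hb : ∀ x, ‖fderiv ℝ η x‖ ≤ b) (hconst : ∀ x ∈ inclusions ω, fderiv ℝ η x = 0) :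
    ∫ x in Ω, normSq (cutoffGradient η u gu x) ≤
      2 * (κ₂ * (d * b ^ 2)) / κ₁ * ∫ x in Ω, ‖u x‖ ^ 2 := by
  set gw := cutoffGradient η u gu with hgw
  let τ : Space d → Mat d := fun x i α => partialDeriv i η x * u x α
  have hgw2 : ∀ i α, MemLp (fun x => gw x i α) 2 volume := fun i α =>
    hu.memH1.memLp_cutoffGradient hΩ hη hs hsub i α
  have hτ2 : ∀ i α, MemLp (fun x => τ x i α) 2 volume := fun i α =>
    hu.memH1.memLp_partialDeriv_mul hΩ hη hs hsub i α
  have hη2 : ContDiff ℝ (⊤ : ℕ∞) fun y => η y * η y := hη.mul hη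
  have hsub2 : tsupport (fun y => η y * η y) ⊆ Ω :=
    (closure_mono (Function.support_mul_subset_left η η)).trans hsub
  have hdη2 : ∀ x ∈ inclusions ω, fderiv ℝ (fun y => η y * η y) x = 0 := fun x hx => by
    have hd : DifferentiableAt ℝ η x := hη.differentiable (by simp) x
    rw [fderiv_fun_mul hd hd, hconst x hx]
    simp
  have hinc : MeasurableSet (inclusions ω) := isClosed_closure.measurableSet.compl
  have hmem : ∀ᵐ x ∂(volume.restrict (Ω ∩ inclusions ω)), x ∈ inclusions ω :=
    (ae_restrict_mem (hΩ.measurableSet.inter hinc)).mono fun x hx => hx.2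
  -- The test field is `η² u`. It is admissible because on the inclusions `∇(η²) = 0`, so that its
  -- gradient is `η² ∇u`, whose symmetric part vanishes.
  have heq := hu.equation _ _ (hu.memH1.memH10_cutoff hΩ hη2 hs.mul_right hsub2) (by
    filter_upwards [hu.rigid, hmem] with x hx hxi
    exact symPart_cutoffGradient_eq_zero (hdη2 x hxi) hx)
  have iw := hA.integrable_contract_self hκ₁.le hκ₂ fun i α => (hgw2 i α).restrict (Ω ∩ ω)
  have iτ := hA.integrable_contract_self hκ₁.le hκ₂ fun i α => (hτ2 i α).restrict (Ω ∩ ω)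
  have henergy : ∫ x in Ω ∩ ω, contract (A x) (gw x) (gw x) =
      ∫ x in Ω ∩ ω, contract (A x) (τ x) (τ x) := by
    rw [← sub_eq_zero, ← integral_sub iw iτ, ← heq]
    refine integral_congr_ae ?_
    filter_upwards [ae_restrict_of_ae hA.elastic] with x hx
    rw [cutoffGradient_sq hη, hx.contract_cutoff]
    rfl
  have hlower : κ₁ * ∫ x in Ω ∩ ω, normSq (symPart (gw x)) ≤
      ∫ x in Ω ∩ ω, contract (A x) (gw x) (gw x) := by
    rw [← integral_const_mul]
    refine integral_mono_ae ((integrable_normSq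
      (memLp_symPart fun i α => (hgw2 i α).restrict (Ω ∩ ω))).const_mul κ₁) iw ?_
    filter_upwards [ae_restrict_of_ae hA.elastic] with x hx using hx.le_contract_self _
  have hu2 : Integrable (fun x => ‖u x‖ ^ 2) (volume.restrict Ω) :=
    hu.memH1.memLp.integrable_norm_pow (by simp)
  have hupper : ∫ x in Ω ∩ ω, contract (A x) (τ x) (τ x) ≤
      κ₂ * (d * b ^ 2) * ∫ x in Ω, ‖u x‖ ^ 2 := by
    calc _ ≤ ∫ x in Ω ∩ ω, κ₂ * (d * b ^ 2) * ‖u x‖ ^ 2 := by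
          refine integral_mono_ae iτ
            ((hu2.mono_measure (Measure.restrict_mono inter_subset_left le_rfl)).const_mul _) ?_
          filter_upwards [ae_restrict_of_ae hA.elastic] with x hx
          refine (hx.contract_self_le hκ₂ _).trans ?_
          rw [mul_assoc]
          exact mul_le_mul_of_nonneg_left (normSq_partialDeriv_mul_le (hb x) (u x)) hκ₂
      _ ≤ ∫ x in Ω, κ₂ * (d * b ^ 2) * ‖u x‖ ^ 2 :=
          setIntegral_mono_set (hu2.const_mul _)
            (Filter.Eventually.of_forall fun x => by positivity) inter_subset_left.eventuallyLE
      _ = _ := integral_const_mul _ _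
  -- Korn's inequality needs `D(η u)` on all of `Ω`, while ellipticity controls it on `ω`; outside
  -- `ω` it vanishes almost everywhere.
  have hsym : ∫ x in Ω, normSq (symPart (gw x)) = ∫ x in Ω ∩ ω, normSq (symPart (gw x)) := by
    refine (setIntegral_eq_of_subset_of_ae_sdiff_eq_zero hΩ.measurableSet.nullMeasurableSet
      inter_subset_left ?_)
    have h1 := (ae_restrict_iff' (hΩ.measurableSet.inter hinc)).1 hu.rigid
    have h2 : ∀ᵐ x ∂(volume : Measure (Space d)), x ∉ ωᶜ \ inclusions ω :=
      measure_eq_zero_iff_ae_notMem.1 hnull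
    filter_upwards [h1, h2] with x hx1 hx2 hx
    have hxi : x ∈ inclusions ω := by
      by_contra h
      exact hx2 ⟨fun hxω => hx.2 ⟨hx.1, hxω⟩, h⟩
    rw [hgw, symPart_cutoffGradient_eq_zero (hconst x hxi) (hx1 ⟨hx.1, hxi⟩)]
    simp [normSq]
  have hkorn := (hu.memH1.memH10_cutoff hΩ hη hs hsub).integral_normSq_le
  rw [← hgw, hsym] at hkorn
  refine hkorn.trans ?_
  rw [mul_div_assoc, mul_assoc 2, div_mul_eq_mul_div]
  refine mul_le_mul_of_nonneg_left ?_ zero_le_two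
  rw [le_div_iff₀ hκ₁, mul_comm]
  linarith

theorem IsMatrixWithInclusions.exists_caccioppoli {d : ℕ} {ω : Set (Space d)}
    {Fs : Set (Set (Space d))} (h : IsMatrixWithInclusions ω Fs) {κ₁ κ₂ : ℝ} (hκ₁ : 0 < κ₁)
    (hκ₂ : 0 ≤ κ₂) :
    ∃ R₀ C : ℝ, 0 < R₀ ∧ 0 ≤ C ∧ ∀ A : Space d → Tensor d, IsCoefficient κ₁ κ₂ A →
      ∀ R : ℝ, R₀ ≤ R → ∀ (u : Space d → Space d) (gu : Space d → Mat d),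
        IsStiffSolution ω A (cube d R) u gu →
        ∫ x in cube d (R / 2), normSq (gu x) ≤ C / R ^ 2 * ∫ x in cube d R, ‖u x‖ ^ 2 := by
  obtain ⟨R₀, C, hR₀, hC, hcut⟩ := h.exists_cutoff
  refine ⟨R₀, 2 * (κ₂ * (d * C ^ 2)) / κ₁, hR₀, by positivity, ?_⟩
  intro A hA R hR u gu hu
  have hRpos : 0 < R := hR₀.trans_le hR
  obtain ⟨η, hη, hs, hsub, hone, hb, hconst⟩ := hcut R hR
  have key := hu.integral_normSq_cutoffGradient_le
    h.volume_compl_diff_inclusions (isOpen_cube d R) hκ₁ hκ₂ hA hη hs hsub hb hconst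
  have hcube : cube d (R / 2) ⊆ cube d R := fun x hx i =>
    ⟨by linarith [(hx i).1], by linarith [(hx i).2]⟩
  calc ∫ x in cube d (R / 2), normSq (gu x)
      = ∫ x in cube d (R / 2), normSq (cutoffGradient η u gu x) := by
        refine setIntegral_congr_fun (isOpen_cube d _).measurableSet fun x hx => ?_
        have hev : η =ᶠ[𝓝 x] fun _ => 1 := by
          filter_upwards [(isOpen_cube d _).mem_nhds hx] with y hy using hone y hy
        have hd : fderiv ℝ η x = 0 := by rw [hev.fderiv_eq, fderiv_const_apply]
        have : cutoffGradient η u gu x = gu x := by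
          ext i α
          simp [cutoffGradient, partialDeriv, hd, hone x hx]
        simp only [this]
    _ ≤ ∫ x in cube d R, normSq (cutoffGradient η u gu x) :=
        setIntegral_mono_set (integrable_normSq fun i α =>
            (hu.memH1.memLp_cutoffGradient (isOpen_cube d R) hη hs hsub i α).restrict _)
          (Filter.Eventually.of_forall fun x => normSq_nonneg _) hcube.eventuallyLE
    _ ≤ _ := key
    _ = _ := by
        congr 1
        field_simp

end StiffInclusion

theorem theorem3p4 (d : ℕ) (ω : Set (StiffInclusion.Space d))
    (hω : StiffInclusion.IsAdmissible ω) (κ₁ κ₂ : ℝ) (hκ₁ : 0 < κ₁) (hκ₂ : 0 < κ₂)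
    (l : ℝ) (hl : 1 ≤ l) :
    ∃ C : ℝ, 0 < C ∧
      ∀ A : StiffInclusion.Space d → StiffInclusion.Tensor d,
        StiffInclusion.IsCoefficient κ₁ κ₂ A →
      ∀ R : ℝ, 32 ≤ R →
      ∀ (u : StiffInclusion.Space d → StiffInclusion.Space d)
        (gu : StiffInclusion.Space d → StiffInclusion.Mat d),
        StiffInclusion.IsStiffSolution ω A (StiffInclusion.cube d R) u gu →
        ∫ x in StiffInclusion.cube d (R / 2), StiffInclusion.normSq (gu x) ≤
          C / R ^ 2 * (∫ x in StiffInclusion.cube d R, ‖u x‖ ^ 2) +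
          C / R ^ (2 * l) * (∫ x in StiffInclusion.cube d R, StiffInclusion.normSq (gu x)) := by
  obtain ⟨Fs, h⟩ := hω
  obtain ⟨R₀, C, hR₀, hC, H⟩ := h.exists_caccioppoli hκ₁ hκ₂.le
  have hpow : 0 < R₀ ^ (2 * l) := Real.rpow_pos_of_pos hR₀ _
  -- The summand `C` serves the radii `R ≥ R₀`; `R₀ ^ (2 * l)` makes the last coefficient at least
  -- `1` for `R < R₀`.
  refine ⟨C + R₀ ^ (2 * l), by positivity, ?_⟩
  intro A hA R hR u gu hu
  have hRpos : 0 < R := by linarith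
  have hU : 0 ≤ ∫ x in StiffInclusion.cube d R, ‖u x‖ ^ 2 :=
    MeasureTheory.integral_nonneg fun x => by positivity
  have hG : 0 ≤ ∫ x in StiffInclusion.cube d R, StiffInclusion.normSq (gu x) :=
    MeasureTheory.integral_nonneg fun x => StiffInclusion.normSq_nonneg _
  have hRl : 0 < R ^ (2 * l) := Real.rpow_pos_of_pos hRpos _
  rcases le_or_gt R₀ R with hle | hlt
  · have h1 := H A hA R hle u gu hu
    have h2 : C / R ^ 2 * (∫ x in StiffInclusion.cube d R, ‖u x‖ ^ 2) ≤
        (C + R₀ ^ (2 * l)) / R ^ 2 * (∫ x in StiffInclusion.cube d R, ‖u x‖ ^ 2) := by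
      gcongr
      linarith
    have h3 : 0 ≤ (C + R₀ ^ (2 * l)) / R ^ (2 * l) *
        (∫ x in StiffInclusion.cube d R, StiffInclusion.normSq (gu x)) := by positivity
    linarith
  · have h1 : ∫ x in StiffInclusion.cube d (R / 2), StiffInclusion.normSq (gu x) ≤
        ∫ x in StiffInclusion.cube d R, StiffInclusion.normSq (gu x) := by
      refine MeasureTheory.setIntegral_mono_set
        (StiffInclusion.integrable_normSq hu.memH1.memLp_grad)
        (Filter.Eventually.of_forall fun x => StiffInclusion.normSq_nonneg _)
        (LE.le.eventuallyLE fun x hx i => ?_)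
      exact ⟨by linarith [(hx i).1], by linarith [(hx i).2]⟩
    have h2 : 1 ≤ (C + R₀ ^ (2 * l)) / R ^ (2 * l) := by
      rw [le_div_iff₀ hRl, one_mul]
      have := Real.rpow_le_rpow hRpos.le hlt.le (by linarith : 0 ≤ 2 * l)
      linarith
    have h3 : 0 ≤ (C + R₀ ^ (2 * l)) / R ^ 2 *
        (∫ x in StiffInclusion.cube d R, ‖u x‖ ^ 2) := by positivity
    have h4 := mul_le_mul_of_nonneg_right h2 hG
    linarith
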